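/- All Lie algebras are real. Each of the seven-dimensional Lie algebras below has a basis $X_1,\dots,X_7$ and brackets $[X_i,X_j]=\sum_k C_{ij}^k X_k$; brackets that are not listed are zero or follow by antisymmetry. Write $(\mathfrak{so})$ for $C_{23}^1=1,\ C_{12}^3=1,\ C_{13}^2=-1$; $(\mathfrak{sl})$ for $C_{12}^2=2,\ C_{13}^3=-2,\ C_{23}^1=1$; and $(D)$ for $C_{14}^4=1,\ C_{15}^5=-1,\ C_{25}^4=1,\ C_{34}^5=1$. - $L_{7,1}$: $(\mathfrak{so})$, $C_{15}^6=1,\ C_{16}^5=-1,\ C_{24}^6=-1,\ C_{26}^4=1,\ C_{34}^5=1,\ C_{35}^4=-1,\ C_{47}^4=C_{57}^5=C_{67}^6=1$. - $L_{7,2}$: $(\mathfrak{so})$, $C_{14}^7=C_{15}^6=C_{24}^5=C_{26}^7=C_{34}^6=C_{37}^5=\tfrac12$, $C_{16}^5=C_{17}^4=C_{25}^4=C_{27}^6=C_{35}^7=C_{36}^4=-\tfrac12$. - $L_{7,3}^p$ ($p\in\mathbb{R}$, $p\neq0$): $(\mathfrak{sl})$, $(D)$, $C_{47}^4=C_{57}^5=1,\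 C_{67}^6=p$. - $L_{7,4}$: $(\mathfrak{sl})$, $(D)$, $C_{45}^6=1,\ C_{47}^4=C_{57}^5=1,\ C_{67}^6=2$. - $L_{7,5}$: $(\mathfrak{sl})$, $C_{14}^4=2,\ C_{16}^6=-2,\ C_{25}^4=2,\ C_{26}^5=1,\ C_{34}^5=1,\ C_{35}^6=2,\ C_{47}^4=C_{57}^5=C_{67}^6=1$. - $L_{7,6}$: $(\mathfrak{sl})$, $C_{14}^4=3,\ C_{15}^5=1,\ C_{16}^6=-1,\ C_{17}^7=-3,\ C_{25}^4=3,\ C_{26}^5=2,\ C_{27}^6=1,\ C_{34}^5=1,\ C_{35}^6=2,\ C_{36}^7=3$. - $L_{7,7}$: $(\mathfrak{sl})$, $(D)$, $C_{16}^6=1,\ C_{17}^7=-1,\ C_{27}^6=1,\ C_{36}^7=1$. Let $H^2(\mathfrak g,\mathfrak g)$ be the second Chevalley–Eilenberg cohomology of $\mathfrak g$ with values in the adjoint module. An $n$-dimensional Lie algebra is called stable if its orbit under $GL(n,\mathbb{R})$ is open in the variety of all Lie algebra laws on $\mathbb{R}^n$ (the set of structure tensors $(C_{ij}^k)$ of Lie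 brackets, with the subspace topology). **Proposition.** For $j\in\{1,2,4,5,6,7\}$, $H^2(L_{7,j},L_{7,j})=0$ and $L_{7,j}$ is stable. For $p\neq0$, $$\dim H^2(L_{7,3}^p,L_{7,3}^p)=\begin{cases}1,& p\neq 2,\\ 2,& p=2.\end{cases}$$ Moreover, let $\varphi_1,\varphi_2$ be the alternating bilinear maps with $\varphi_1(X_6,X_7)=X_6$ and $\varphi_2(X_4,X_5)=X_6$, all other values on pairs $X_i,X_j$ with $i<j$ being zero. If $p\neq0,2$, then $\varphi_1$ is a $2$-cocycle of $L_{7,3}^p$ and $[\varphi_1]$ spans $H^2(L_{7,3}^p,L_{7,3}^p)$; if $p=2$, then $\varphi_1$ and $\varphi_2$ are $2$-cocycles of $L_{7,3}^2$ and $[\varphi_1],[\varphi_2]$ span $H^2(L_{7,3}^2,L_{7,3}^2)$. -/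

import Mathlib

-- Mathlib's own project-wide value of this option.
set_option maxSynthPendingDepth 3

open LieModule.Cohomology

noncomputable section

/-- The bilinear map `ℝⁿ × ℝⁿ → ℝⁿ` with coordinates `C`:
`(X_i, X_j) ↦ ∑ k, C i j k • X_k` on the standard basis. -/
def tensorMap {n : ℕ} (C : Fin n → Fin n → Fin n → ℝ) :
    (Fin n → ℝ) →ₗ[ℝ] (Fin n → ℝ) →ₗ[ℝ] (Fin n → ℝ) :=
  LinearMap.mk₂ ℝ (fun x y k => ∑ i, ∑ j, C i j k * x i * y j)
    (fun x x' y => by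
      ext k; simp only [Pi.add_apply, mul_add, add_mul, Finset.sum_add_distrib])
    (fun c x y => by
      ext k; simp only [Pi.smul_apply, smul_eq_mul, Finset.mul_sum]
      exact Finset.sum_congr rfl fun i _ => Finset.sum_congr rfl fun j _ => by ring)
    (fun x y y' => by
      ext k; simp only [Pi.add_apply, mul_add, Finset.sum_add_distrib])
    (fun c x y => by
      ext k; simp only [Pi.smul_apply, smul_eq_mul, Finset.mul_sum]
      exact Finset.sum_congr rfl fun i _ => Finset.sum_congr rfl fun j _ => by ring)

theorem tensorMap_apply {n : ℕ} (C : Fin n → Fin n → Fin n → ℝ) (x y : Fin n → ℝ) (k : Fin n) :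
    tensorMap C x y k = ∑ i, ∑ j, C i j k * x i * y j := rfl

/-- The variety of real Lie algebra laws on `ℝⁿ`, in coordinates: the structure tensors of
alternating bilinear maps that satisfy the Jacobi identity. -/
def LieLaw (n : ℕ) : Type :=
  {C : Fin n → Fin n → Fin n → ℝ //
    (∀ x, tensorMap C x x = 0) ∧
    ∀ x y z, tensorMap C x (tensorMap C y z) + tensorMap C y (tensorMap C z x) +
      tensorMap C z (tensorMap C x y) = 0}

/-- The variety of laws carries the subspace topology of the space of structure tensors. -/
instance (n : ℕ) : TopologicalSpace (LieLaw n) :=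
  inferInstanceAs (TopologicalSpace (Subtype _))

namespace LieLaw

variable {n : ℕ}

/-- The bracket of a Lie algebra law. -/
def bracket (μ : LieLaw n) : (Fin n → ℝ) →ₗ[ℝ] (Fin n → ℝ) →ₗ[ℝ] (Fin n → ℝ) :=
  tensorMap μ.1

/-- The orbit of a law under the action of the general linear group of `ℝⁿ` on the variety of
laws, i.e. the set of all laws isomorphic to it. -/
def orbit (μ : LieLaw n) : Set (LieLaw n) :=
  {ν | ∃ g : (Fin n → ℝ) ≃ₗ[ℝ] (Fin n → ℝ),
    ∀ x y, ν.bracket x y = g (μ.bracket (g.symm x) (g.symm y))}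

/-- A Lie algebra is stable if its orbit is open in the variety of laws. -/
def IsStable (μ : LieLaw n) : Prop := IsOpen μ.orbit

/-- The Lie algebra `(ℝⁿ, μ)`. -/
def Alg (_μ : LieLaw n) : Type := Fin n → ℝ

instance (μ : LieLaw n) : AddCommGroup μ.Alg := inferInstanceAs (AddCommGroup (Fin n → ℝ))

instance (μ : LieLaw n) : Module ℝ μ.Alg := inferInstanceAs (Module ℝ (Fin n → ℝ))

theorem bracket_skew (μ : LieLaw n) (x y : Fin n → ℝ) : μ.bracket x y = -μ.bracket y x := by
  have h := μ.2.1 (x + y)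
  have hx := μ.2.1 x
  have hy := μ.2.1 y
  simp only [map_add, LinearMap.add_apply, hx, hy, zero_add, add_zero] at h
  rw [add_comm] at h
  exact eq_neg_of_add_eq_zero_left h

instance (μ : LieLaw n) : LieRing μ.Alg where
  bracket x y := μ.bracket x y
  add_lie x y z := LinearMap.congr_fun (map_add μ.bracket x y) z
  lie_add x y z := map_add (μ.bracket x) y z
  lie_self x := μ.2.1 x
  leibniz_lie x y z := by
    change μ.bracket x (μ.bracket y z) =
      μ.bracket (μ.bracket x y) z + μ.bracket y (μ.bracket x z)
    have h : μ.bracket x (μ.bracket y z) + μ.bracket y (μ.bracket z x) +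
      μ.bracket z (μ.bracket x y) = 0 := μ.2.2 x y z
    rw [bracket_skew μ (μ.bracket x y) z, bracket_skew μ x z, map_neg]
    rw [add_assoc] at h
    rw [eq_neg_of_add_eq_zero_left h]
    abel

instance (μ : LieLaw n) : LieAlgebra ℝ μ.Alg where
  lie_smul c x y := map_smul (μ.bracket x) c y

end LieLaw

section Cohomology

variable (L : Type*) [LieRing L] [LieAlgebra ℝ L]

/-- The 2-coboundaries of `L` with values in the adjoint module, inside the 2-cocycles
(every coboundary is a cocycle). -/
def adjointCoboundaries : Submodule ℝ (twoCocycle ℝ L L) :=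
  (LinearMap.range (d₁₂ ℝ L L)).submoduleOf (twoCocycle ℝ L L)

/-- The second adjoint cohomology space `H²(L, L) = Z²(L, L) / B²(L, L)`. -/
abbrev AdjointH2 : Type _ := twoCocycle ℝ L L ⧸ adjointCoboundaries L

end Cohomology

/-- The cohomology class of a 2-cocycle. -/
def cohomologyClass {L : Type*} [LieRing L] [LieAlgebra ℝ L] (φ : twoCochain ℝ L L)
    (hφ : φ ∈ twoCocycle ℝ L L) : AdjointH2 L :=
  Submodule.Quotient.mk ⟨φ, hφ⟩


section Tables

variable {n : ℕ}

/-- The structure tensor given by a table of entries `(i, j, k, v)`, each of which stands for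
`C_{ij}^k = v`. Indices in the table run from `1` to `n`; values not listed are zero or obtained
by antisymmetry. -/
def tableTensor (l : List (ℕ × ℕ × ℕ × ℝ)) (i j k : Fin n) : ℝ :=
  (l.map fun e =>
    (if i.val + 1 = e.1 ∧ j.val + 1 = e.2.1 ∧ k.val + 1 = e.2.2.1 then e.2.2.2 else 0) -
    (if j.val + 1 = e.1 ∧ i.val + 1 = e.2.1 ∧ k.val + 1 = e.2.2.1 then e.2.2.2 else 0)).sum

/-- The coordinate of `x` with label `a ∈ {1, …, n}`. -/
def coord (x : Fin n → ℝ) (a : ℕ) : ℝ := ∑ i : Fin n, if i.val + 1 = a then x i else 0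

theorem tensorMap_tableTensor (l : List (ℕ × ℕ × ℕ × ℝ)) (x y : Fin n → ℝ) (k : Fin n) :
    tensorMap (tableTensor l) x y k =
      (l.map fun e => if k.val + 1 = e.2.2.1 then
        e.2.2.2 * (coord x e.1 * coord y e.2.1 - coord x e.2.1 * coord y e.1) else 0).sum := by
  rw [tensorMap_apply]
  induction l with
  | nil => simp [tableTensor]
  | cons e l ih =>
    have h : ∀ i j : Fin n, tableTensor (e :: l) i j k =
      ((if i.val + 1 = e.1 ∧ j.val + 1 = e.2.1 ∧ k.val + 1 = e.2.2.1 then e.2.2.2 else 0) -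
      (if j.val + 1 = e.1 ∧ i.val + 1 = e.2.1 ∧ k.val + 1 = e.2.2.1 then e.2.2.2 else 0)) +
      tableTensor l i j k := fun i j => by simp [tableTensor]
    simp only [h, add_mul, Finset.sum_add_distrib, ih, List.map_cons, List.sum_cons]
    congr 1
    split_ifs with hk
    · simp only [coord, Finset.sum_mul_sum]
      simp only [← Finset.sum_sub_distrib, Finset.mul_sum, hk, and_true]
      refine Finset.sum_congr rfl fun i _ => Finset.sum_congr rfl fun j _ => ?_
      simp only [ite_and]
      split_ifs <;> ring
    · simp [hk]

theorem tensorMap_tableTensor_self (l : List (ℕ × ℕ × ℕ × ℝ)) (x : Fin n → ℝ) :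
    tensorMap (tableTensor l) x x = 0 := by
  ext k
  rw [tensorMap_tableTensor]
  apply List.sum_eq_zero
  intro a ha
  obtain ⟨e, -, rfl⟩ := List.mem_map.1 ha
  split_ifs <;> simp [mul_comm]

/-- The 2-cochain `φ(X_i, X_j) = ∑ k, C_{ij}^k X_k` of `(ℝⁿ, μ)` given by a table. -/
def tableCochain (μ : LieLaw n) (l : List (ℕ × ℕ × ℕ × ℝ)) : twoCochain ℝ μ.Alg μ.Alg :=
  ⟨(tensorMap (n := n) (tableTensor l) :
      (Fin n → ℝ) →ₗ[ℝ] (Fin n → ℝ) →ₗ[ℝ] (Fin n → ℝ)), tensorMap_tableTensor_self l⟩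

theorem coord_seven (x : Fin 7 → ℝ) :
    coord x 1 = x 0 ∧ coord x 2 = x 1 ∧ coord x 3 = x 2 ∧ coord x 4 = x 3 ∧ coord x 5 = x 4 ∧
      coord x 6 = x 5 ∧ coord x 7 = x 6 := by
  simp [coord, Fin.sum_univ_seven]

end Tables

/-! ### The seven-dimensional indecomposable Lie algebras with nontrivial Levi decomposition -/

/-- Structure constants of `so(3)`. -/
def so3Table : List (ℕ × ℕ × ℕ × ℝ) := [(2, 3, 1, 1), (1, 2, 3, 1), (1, 3, 2, -1)]

/-- Structure constants of `sl(2, ℝ)`. -/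
def sl2Table : List (ℕ × ℕ × ℕ × ℝ) := [(1, 2, 2, 2), (1, 3, 3, -2), (2, 3, 1, 1)]

/-- `L_{7,1}`. -/
def L71 : LieLaw 7 :=
  ⟨tableTensor (so3Table ++
    [(1, 5, 6, 1), (1, 6, 5, -1), (2, 4, 6, -1), (2, 6, 4, 1), (3, 4, 5, 1), (3, 5, 4, -1),
     (4, 7, 4, 1), (5, 7, 5, 1), (6, 7, 6, 1)]),
    tensorMap_tableTensor_self _, by
    intro x y z
    ext k
    fin_cases k <;> simp [tensorMap_tableTensor, so3Table, coord_seven] <;> ring⟩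

/-- `L_{7,2}`. -/
def L72 : LieLaw 7 :=
  ⟨tableTensor (so3Table ++
    [(1, 4, 7, 1/2), (1, 5, 6, 1/2), (1, 6, 5, -1/2), (1, 7, 4, -1/2),
     (2, 4, 5, 1/2), (2, 5, 4, -1/2), (2, 6, 7, 1/2), (2, 7, 6, -1/2),
     (3, 4, 6, 1/2), (3, 5, 7, -1/2), (3, 6, 4, -1/2), (3, 7, 5, 1/2)]),
    tensorMap_tableTensor_self _, by
    intro x y z
    ext k
    fin_cases k <;> simp [tensorMap_tableTensor, so3Table, coord_seven] <;> ring⟩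

/-- `L_{7,3}^p` (the family has `p ≠ 0`). -/
def L73 (p : ℝ) : LieLaw 7 :=
  ⟨tableTensor (sl2Table ++
    [(1, 4, 4, 1), (1, 5, 5, -1), (2, 5, 4, 1), (3, 4, 5, 1),
     (4, 7, 4, 1), (5, 7, 5, 1), (6, 7, 6, p)]),
    tensorMap_tableTensor_self _, by
    intro x y z
    ext k
    fin_cases k <;> simp [tensorMap_tableTensor, sl2Table, coord_seven] <;> ring⟩

/-- `L_{7,4}`. -/
def L74 : LieLaw 7 :=
  ⟨tableTensor (sl2Table ++
    [(1, 4, 4, 1), (1, 5, 5, -1), (2, 5, 4, 1), (3, 4, 5, 1),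
     (4, 5, 6, 1), (4, 7, 4, 1), (5, 7, 5, 1), (6, 7, 6, 2)]),
    tensorMap_tableTensor_self _, by
    intro x y z
    ext k
    fin_cases k <;> simp [tensorMap_tableTensor, sl2Table, coord_seven] <;> ring⟩

/-- `L_{7,5}`. -/
def L75 : LieLaw 7 :=
  ⟨tableTensor (sl2Table ++
    [(1, 4, 4, 2), (1, 6, 6, -2), (2, 5, 4, 2), (2, 6, 5, 1), (3, 4, 5, 1), (3, 5, 6, 2),
     (4, 7, 4, 1), (5, 7, 5, 1), (6, 7, 6, 1)]),
    tensorMap_tableTensor_self _, by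
    intro x y z
    ext k
    fin_cases k <;> simp [tensorMap_tableTensor, sl2Table, coord_seven] <;> ring⟩

/-- `L_{7,6}`. -/
def L76 : LieLaw 7 :=
  ⟨tableTensor (sl2Table ++
    [(1, 4, 4, 3), (1, 5, 5, 1), (1, 6, 6, -1), (1, 7, 7, -3),
     (2, 5, 4, 3), (2, 6, 5, 2), (2, 7, 6, 1),
     (3, 4, 5, 1), (3, 5, 6, 2), (3, 6, 7, 3)]),
    tensorMap_tableTensor_self _, by
    intro x y z
    ext k
    fin_cases k <;> simp [tensorMap_tableTensor, sl2Table, coord_seven] <;> ring⟩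

/-- `L_{7,7}`. -/
def L77 : LieLaw 7 :=
  ⟨tableTensor (sl2Table ++
    [(1, 4, 4, 1), (1, 5, 5, -1), (2, 5, 4, 1), (3, 4, 5, 1),
     (1, 6, 6, 1), (1, 7, 7, -1), (2, 7, 6, 1), (3, 6, 7, 1)]),
    tensorMap_tableTensor_self _, by
    intro x y z
    ext k
    fin_cases k <;> simp [tensorMap_tableTensor, sl2Table, coord_seven] <;> ring⟩

/-- The 2-cochain of `L_{7,3}^p` with `φ₁(X₆, X₇) = X₆`. -/
def phi1 (p : ℝ) : twoCochain ℝ (L73 p).Alg (L73 p).Alg := tableCochain (L73 p) [(6, 7, 6, 1)]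

/-- The 2-cochain of `L_{7,3}^p` with `φ₂(X₄, X₅) = X₆`. -/
def phi2 (p : ℝ) : twoCochain ℝ (L73 p).Alg (L73 p).Alg := tableCochain (L73 p) [(4, 5, 6, 1)]

end

/-! Two arguments are combined: a Hodge-type computation of cohomology and the Nijenhuis–Richardson
theorem that `H² = 0` implies stability.

Cohomology. A positive diagonal form on the algebra induces an inner product on 2-cochains, and
every cocycle is a coboundary plus a harmonic cocycle `ψ`, one orthogonal to all coboundaries.
Suppose that the adjoint of `ad y` for this form is again an inner derivation `ad x`. Then `‖y·ψ‖² =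
⟨ψ, x·(y·ψ)⟩`. By Cartan's formula `x·(y·ψ)` is a coboundary, so `y·ψ = 0`
(`IsHarmonic.tensorAction_eq_zero`). The form is chosen so that this applies to the Levi factor:
`so(3)` acts by skew matrices, while in `sl(2)` the element `X₁` is self-adjoint and `X₂`, `X₃` are
adjoint to each other. It also applies to `X₇` whenever `ad X₇` is diagonal. Harmonic cocycles are
therefore equivariant maps and depend on a handful of scalars. A few cocycle equations, and
orthogonality to coboundaries of diagonal endomorphisms, eliminate these.

For `L_{7,3}^p` two linear forms that vanish on coboundaries detect the classes that remain: `φ₁` is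
the direction in which `p` varies, and `φ₂`, for `p = 2`, the direction towards `L_{7,4}`.

Stability. Let `W` be a complement of the solutions of the linearized law equations at `μ`. These
equations are injective on `W` to first order, so `μ` is an isolated law in `μ + W`. If `H² = 0`,
coboundaries and `W` span all tensors, so by the surjective form of the inverse function theorem
each tensor near `μ` is carried into `μ + W` by some `1 + X` with `X` small. For a law the image is
again a law, hence equals `μ` (`LieLaw.orbit_mem_nhds`). -/

noncomputable section

/-! ### Diagonal inner products on tensors of type (2, 1). -/

section Tensor

variable {ι : Type*} [Fintype ι]

/-- The action of an endomorphism `A` (with `A i m` the coefficient of the `m`-th basis vector in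
the image of the `i`-th) on bilinear maps, in coordinates. -/
def tensorAction (A : ι → ι → ℝ) (c : ι → ι → ι → ℝ) (i j k : ι) : ℝ :=
  ∑ m, (A m k * c i j m - A i m * c m j k - A j m * c i m k)

/-- The diagonal form on tensors of type `(2, 1)` induced by the form `diag w` on vectors. -/
def tensorForm (w : ι → ℝ) (c e : ι → ι → ι → ℝ) : ℝ :=
  ∑ i, ∑ j, ∑ k, w k / (w i * w j) * (c i j k * e i j k)

theorem tensorForm_comm (w : ι → ℝ) (c e : ι → ι → ι → ℝ) :
    tensorForm w c e = tensorForm w e c := by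
  simp only [tensorForm, mul_comm (c _ _ _)]

theorem eq_zero_of_tensorForm_self {w : ι → ℝ} (hw : ∀ i, 0 < w i) {c : ι → ι → ι → ℝ}
    (h : tensorForm w c c = 0) : c = 0 := by
  have hpos : ∀ i j k, 0 ≤ w k / (w i * w j) * (c i j k * c i j k) := fun i j k =>
    mul_nonneg (div_nonneg (hw k).le (mul_pos (hw i) (hw j)).le) (mul_self_nonneg _)
  ext i j k
  unfold tensorForm at h
  rw [Finset.sum_eq_zero_iff_of_nonneg fun i _ => Finset.sum_nonneg fun j _ =>
    Finset.sum_nonneg fun k _ => hpos i j k] at h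
  have h := h i (Finset.mem_univ _)
  rw [Finset.sum_eq_zero_iff_of_nonneg fun j _ => Finset.sum_nonneg fun k _ => hpos i j k] at h
  have h := h j (Finset.mem_univ _)
  rw [Finset.sum_eq_zero_iff_of_nonneg fun k _ => hpos i j k] at h
  have h := h k (Finset.mem_univ _)
  have hne : w k / (w i * w j) ≠ 0 := (div_pos (hw k) (mul_pos (hw i) (hw j))).ne'
  simpa [hne] using h

/-- If `A` and `A'` are adjoint for the form `diag w`, then so are their actions on tensors. -/
theorem tensorForm_tensorAction {w : ι → ℝ} (hw : ∀ i, 0 < w i) {A A' : ι → ι → ℝ}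
    (hA : ∀ i m, w m * A i m = w i * A' m i) (c e : ι → ι → ι → ℝ) :
    tensorForm w (tensorAction A c) e = tensorForm w c (tensorAction A' e) := by
  have hA' : ∀ i m, A i m / w i = A' m i / w m := fun i m => by
    rw [div_eq_div_iff (hw i).ne' (hw m).ne']; linarith [hA i m]
  -- The three terms of the action are handled separately. In each, the summation index `m` is
  -- swapped with the index it replaces; the adjointness relation then gives equality term by term.
  have h₁ : ∑ i, ∑ j, ∑ k, ∑ m, w k / (w i * w j) * (A m k * c i j m * e i j k) =
      ∑ i, ∑ j, ∑ k, ∑ m, w k / (w i * w j) * (c i j k * (A' m k * e i j m)) := by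
    refine Finset.sum_congr rfl fun i _ => Finset.sum_congr rfl fun j _ => ?_
    rw [Finset.sum_comm]
    refine Finset.sum_congr rfl fun m _ => Finset.sum_congr rfl fun k _ => ?_
    linear_combination (c i j m * e i j k / (w i * w j)) * hA m k
  have h₂ : ∑ i, ∑ j, ∑ k, ∑ m, w k / (w i * w j) * (A i m * c m j k * e i j k) =
      ∑ i, ∑ j, ∑ k, ∑ m, w k / (w i * w j) * (c i j k * (A' i m * e m j k)) := by
    have := Finset.sum_comm (s := Finset.univ) (t := Finset.univ) (f := fun i m =>
      ∑ j, ∑ k, w k / (w i * w j) * (A i m * c m j k * e i j k))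
    have e₁ : ∀ F : ι → ι → ι → ι → ℝ, ∑ i, ∑ j, ∑ k, ∑ m, F i j k m =
        ∑ i, ∑ m, ∑ j, ∑ k, F i j k m := fun F => by
      refine Finset.sum_congr rfl fun i _ => ?_
      rw [Finset.sum_comm (s := Finset.univ) (t := Finset.univ) (f := fun m j => ∑ k, F i j k m)]
      exact Finset.sum_congr rfl fun j _ => Finset.sum_comm
    refine (e₁ _).trans (this.trans (Eq.trans ?_ (e₁ _).symm))
    refine Finset.sum_congr rfl fun m _ => Finset.sum_congr rfl fun i _ =>
      Finset.sum_congr rfl fun j _ => Finset.sum_congr rfl fun k _ => ?_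
    rw [← div_div, ← div_div, div_right_comm, div_right_comm (w k) (w m)]
    linear_combination (w k / w j * c m j k * e i j k) * hA' i m
  have h₃ : ∑ i, ∑ j, ∑ k, ∑ m, w k / (w i * w j) * (A j m * c i m k * e i j k) =
      ∑ i, ∑ j, ∑ k, ∑ m, w k / (w i * w j) * (c i j k * (A' j m * e i m k)) := by
    refine Finset.sum_congr rfl fun i _ => ?_
    have e₁ : ∀ F : ι → ι → ι → ℝ, ∑ j, ∑ k, ∑ m, F j k m = ∑ j, ∑ m, ∑ k, F j k m := fun F =>
      Finset.sum_congr rfl fun j _ => Finset.sum_comm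
    refine (e₁ _).trans (Finset.sum_comm.trans (Eq.trans ?_ (e₁ _).symm))
    refine Finset.sum_congr rfl fun m _ => Finset.sum_congr rfl fun j _ =>
      Finset.sum_congr rfl fun k _ => ?_
    rw [← div_div, ← div_div]
    linear_combination (w k / w i * c i m k * e i j k) * hA' j m
  simp only [tensorForm, tensorAction, Finset.sum_mul, Finset.mul_sum, sub_mul, mul_sub,
    Finset.sum_sub_distrib] at h₁ h₂ h₃ ⊢
  rw [h₁, h₂, h₃]

end Tensor

/-! ### Harmonic cocycles and their invariance. -/

section Harmonic

variable {L : Type*} [LieRing L] [LieAlgebra ℝ L]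

theorem d₁₂_mem_twoCocycle (f : oneCochain ℝ L L) : d₁₂ ℝ L L f ∈ twoCocycle ℝ L L := by
  rw [mem_twoCocycle_iff]
  exact LinearMap.congr_fun (d₂₃_comp_d₁₂ ℝ L L) f

theorem subsingleton_adjointH2_iff : Subsingleton (AdjointH2 L) ↔
    ∀ φ ∈ twoCocycle ℝ L L, ∃ f, d₁₂ ℝ L L f = φ := by
  rw [Submodule.Quotient.subsingleton_iff, Submodule.eq_top_iff']
  simp [adjointCoboundaries, Submodule.submoduleOf]

/-- Cartan's formula for cocycles: the Lie derivative along `x` is the coboundary of the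
contraction with `x`. -/
theorem d₁₂_contraction {φ : twoCochain ℝ L L} (hφ : φ ∈ twoCocycle ℝ L L) (x u v : L) :
    d₁₂ ℝ L L (φ x) u v = ⁅x, φ u v⁆ - φ ⁅x, u⁆ v - φ u ⁅x, v⁆ := by
  have h := LinearMap.congr_fun (LinearMap.congr_fun (LinearMap.congr_fun
    ((mem_twoCocycle_iff ℝ L L φ).1 hφ) x) u) v
  simp only [d₂₃_apply, LinearMap.zero_apply] at h
  rw [d₁₂_apply_apply, ← twoCochain_skew φ ⁅x, v⁆ u, ← twoCochain_skew φ ⁅u, v⁆ x]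
  rw [← sub_eq_zero, ← neg_eq_zero, ← h]
  abel

variable {ι : Type*} (b : Module.Basis ι ℝ L)

/-- The structure constants of a Lie algebra in a basis. -/
def structureConst (i j k : ι) : ℝ := b.repr ⁅b i, b j⁆ k

/-- The coordinates of a 2-cochain with values in the adjoint module. -/
def cochainCoeff : twoCochain ℝ L L →ₗ[ℝ] ι → ι → ι → ℝ where
  toFun φ i j k := b.repr (φ (b i) (b j)) k
  map_add' φ ψ := by ext; simp
  map_smul' r φ := by ext; simp

theorem cochainCoeff_apply (φ : twoCochain ℝ L L) (i j k : ι) :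
    cochainCoeff b φ i j k = b.repr (φ (b i) (b j)) k := rfl

theorem cochainCoeff_injective : Function.Injective (cochainCoeff b) := by
  intro φ ψ h
  refine Subtype.ext (b.ext fun i => b.ext fun j => b.repr.injective (Finsupp.ext fun k => ?_))
  exact congrFun (congrFun (congrFun h i) j) k

theorem cochainCoeff_skew (φ : twoCochain ℝ L L) (i j k : ι) :
    cochainCoeff b φ i j k = -cochainCoeff b φ j i k := by
  rw [cochainCoeff_apply, cochainCoeff_apply, ← twoCochain_skew]; simp

variable [Fintype ι]

theorem repr_apply_eq_sum (g : L →ₗ[ℝ] L) (x : L) (k : ι) :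
    b.repr (g x) k = ∑ m, b.repr x m * b.repr (g (b m)) k := by
  conv_lhs => rw [← b.sum_repr x, map_sum, map_sum, Finsupp.finsetSum_apply]
  simp

theorem repr_lie_eq_sum (x y : L) (k : ι) :
    b.repr ⁅x, y⁆ k = ∑ m, b.repr ⁅x, b m⁆ k * b.repr y m := by
  have := repr_apply_eq_sum b (LieAlgebra.ad ℝ L x) y k
  simpa [mul_comm] using! this

theorem repr_cochain_left (φ : twoCochain ℝ L L) (x y : L) (k : ι) :
    b.repr (φ x y) k = ∑ m, b.repr x m * b.repr (φ (b m) y) k := by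
  simpa using! repr_apply_eq_sum b (φ.1.flip y) x k

theorem repr_cochain_right (φ : twoCochain ℝ L L) (x y : L) (k : ι) :
    b.repr (φ x y) k = ∑ m, b.repr y m * b.repr (φ x (b m)) k :=
  repr_apply_eq_sum b (φ x) y k

theorem cochainCoeff_d₁₂ (f : oneCochain ℝ L L) (i j k : ι) :
    cochainCoeff b (d₁₂ ℝ L L f) i j k = ∑ m, (structureConst b i m k * b.repr (f (b j)) m -
      structureConst b j m k * b.repr (f (b i)) m - structureConst b i j m * b.repr (f (b m)) k) := by
  rw [cochainCoeff_apply, d₁₂_apply_apply]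
  simp only [map_sub, Finsupp.sub_apply, repr_lie_eq_sum b _ (f _), repr_apply_eq_sum b f ⁅_, _⁆,
    Finset.sum_sub_distrib, structureConst]

theorem cochainCoeff_twoCocycle {φ : twoCochain ℝ L L} (hφ : φ ∈ twoCocycle ℝ L L) (i j l k : ι) :
    ∑ m, (structureConst b i m k * cochainCoeff b φ j l m -
      structureConst b j m k * cochainCoeff b φ i l m +
      structureConst b l m k * cochainCoeff b φ i j m -
      structureConst b i j m * cochainCoeff b φ m l k +
      structureConst b i l m * cochainCoeff b φ m j k -
      structureConst b j l m * cochainCoeff b φ m i k) = 0 := by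
  have h := LinearMap.congr_fun (LinearMap.congr_fun (LinearMap.congr_fun
    ((mem_twoCocycle_iff ℝ L L φ).1 hφ) (b i)) (b j)) (b l)
  have h := congrArg (fun v => b.repr v k) h
  simp only [d₂₃_apply, LinearMap.zero_apply, map_sub, map_add, Finsupp.sub_apply, map_zero,
    Finsupp.add_apply, Finsupp.zero_apply, repr_lie_eq_sum b _ (φ _ _),
    repr_cochain_left b φ ⁅_, _⁆] at h
  simpa only [Finset.sum_sub_distrib, Finset.sum_add_distrib, structureConst,
    cochainCoeff_apply] using h

theorem cochainCoeff_d₁₂_contraction {φ : twoCochain ℝ L L} (hφ : φ ∈ twoCocycle ℝ L L) (x : L) :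
    cochainCoeff b (d₁₂ ℝ L L (φ x)) =
      tensorAction (fun i m => b.repr ⁅x, b i⁆ m) (cochainCoeff b φ) := by
  ext i j k
  rw [cochainCoeff_apply, d₁₂_contraction hφ]
  simp only [map_sub, Finsupp.sub_apply, repr_lie_eq_sum b _ (φ _ _),
    repr_cochain_left b φ ⁅_, _⁆, repr_cochain_right b φ _ ⁅_, _⁆, tensorAction,
    Finset.sum_sub_distrib, cochainCoeff_apply]

/-- The bilinear form on 2-cochains induced by the form `diag w` in the basis `b`. -/
def cochainForm (w : ι → ℝ) : LinearMap.BilinForm ℝ (twoCochain ℝ L L) :=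
  LinearMap.mk₂ ℝ (fun φ ψ => tensorForm w (cochainCoeff b φ) (cochainCoeff b ψ))
    (fun φ φ' ψ => by
      simp only [tensorForm, map_add, Pi.add_apply, add_mul, mul_add, Finset.sum_add_distrib])
    (fun r φ ψ => by
      simp only [tensorForm, map_smul, Pi.smul_apply, smul_eq_mul, Finset.mul_sum]
      simp only [mul_assoc, mul_left_comm r])
    (fun φ ψ ψ' => by
      simp only [tensorForm, map_add, Pi.add_apply, mul_add, Finset.sum_add_distrib])
    (fun r φ ψ => by
      simp only [tensorForm, map_smul, Pi.smul_apply, smul_eq_mul, Finset.mul_sum]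
      simp only [mul_left_comm r])

theorem cochainForm_apply (w : ι → ℝ) (φ ψ : twoCochain ℝ L L) :
    cochainForm b w φ ψ = tensorForm w (cochainCoeff b φ) (cochainCoeff b ψ) := rfl

/-- A 2-cocycle is harmonic, for the metric `diag w` in the basis `b`, if it is orthogonal to all
coboundaries. -/
structure IsHarmonic (w : ι → ℝ) (ψ : twoCochain ℝ L L) : Prop where
  mem_twoCocycle : ψ ∈ twoCocycle ℝ L L
  orthogonal : ∀ f, tensorForm w (cochainCoeff b ψ) (cochainCoeff b (d₁₂ ℝ L L f)) = 0

/-- Every cohomology class has a harmonic representative. -/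
theorem exists_isHarmonic_add_d₁₂ {w : ι → ℝ} (hw : ∀ i, 0 < w i) {φ : twoCochain ℝ L L}
    (hφ : φ ∈ twoCocycle ℝ L L) : ∃ ψ f, IsHarmonic b w ψ ∧ φ = ψ + d₁₂ ℝ L L f := by
  have : FiniteDimensional ℝ (twoCochain ℝ L L) :=
    FiniteDimensional.of_injective _ (cochainCoeff_injective b)
  have hrefl : (cochainForm b w).IsRefl := fun φ ψ h => by
    rwa [cochainForm_apply, tensorForm_comm]
  -- By positive definiteness no nonzero coboundary is orthogonal to all coboundaries, so in finite
  -- dimension the orthogonal space is a complement.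
  have hdisj : Disjoint (LinearMap.range (d₁₂ ℝ L L))
      ((cochainForm b w).orthogonal (LinearMap.range (d₁₂ ℝ L L))) := by
    rw [Submodule.disjoint_def]
    intro χ h₁ h₂
    have h := h₂ χ h₁
    apply cochainCoeff_injective b
    rw [map_zero]
    exact eq_zero_of_tensorForm_self hw h
  have hcompl := (LinearMap.BilinForm.isCompl_orthogonal_iff_disjoint hrefl).2 hdisj
  obtain ⟨χ, ⟨f, rfl⟩, ψ, hψ, h⟩ := Submodule.mem_sup.1
    (hcompl.sup_eq_top ▸ Submodule.mem_top : φ ∈ _)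
  refine ⟨ψ, f, ⟨?_, fun g => ?_⟩, by rw [← h, add_comm]⟩
  · rw [← h] at hφ
    exact (Submodule.add_mem_iff_right _ (d₁₂_mem_twoCocycle f)).1 hφ
  · rw [tensorForm_comm]
    exact hψ _ ⟨g, rfl⟩

variable {b}

/-- A harmonic cocycle is invariant under each element whose adjoint action has an adjoint
among the inner derivations. -/
theorem IsHarmonic.tensorAction_eq_zero {w : ι → ℝ} (hw : ∀ i, 0 < w i) {ψ : twoCochain ℝ L L}
    (hψ : IsHarmonic b w ψ) {x y : L}
    (hxy : ∀ i k, w k * b.repr ⁅y, b i⁆ k = w i * b.repr ⁅x, b k⁆ i) :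
    tensorAction (fun i m => b.repr ⁅y, b i⁆ m) (cochainCoeff b ψ) = 0 := by
  apply eq_zero_of_tensorForm_self hw
  -- Moving one factor across gives `⟨ψ, x·(y·ψ)⟩`. Cartan's formula is used twice: `y·ψ` is a
  -- coboundary, hence a cocycle, so `x·(y·ψ)` is a coboundary as well.
  rw [tensorForm_tensorAction hw hxy, ← cochainCoeff_d₁₂_contraction b hψ.mem_twoCocycle,
    ← cochainCoeff_d₁₂_contraction b (d₁₂_mem_twoCocycle _)]
  exact hψ.orthogonal _

end Harmonic

/-! ### Bilinear maps in coordinates, and derivatives of polynomial maps. -/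

section Bilinear

variable {n : ℕ}

/-- The tensor of coordinates of a bilinear map. -/
def bilinTensor (B : (Fin n → ℝ) →ₗ[ℝ] (Fin n → ℝ) →ₗ[ℝ] (Fin n → ℝ)) (i j k : Fin n) : ℝ :=
  B (Pi.single i 1) (Pi.single j 1) k

theorem tensorMap_single (C : Fin n → Fin n → Fin n → ℝ) (i j : Fin n) :
    tensorMap C (Pi.single i 1) (Pi.single j 1) = C i j := by
  ext k
  simp [tensorMap_apply, Pi.single_apply]

theorem bilin_ext {B B' : (Fin n → ℝ) →ₗ[ℝ] (Fin n → ℝ) →ₗ[ℝ] (Fin n → ℝ)}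
    (h : ∀ i j, B (Pi.single i 1) (Pi.single j 1) = B' (Pi.single i 1) (Pi.single j 1)) :
    B = B' :=
  (Pi.basisFun ℝ (Fin n)).ext fun i => (Pi.basisFun ℝ (Fin n)).ext fun j => by simpa using h i j

theorem tensorMap_bilinTensor (B : (Fin n → ℝ) →ₗ[ℝ] (Fin n → ℝ) →ₗ[ℝ] (Fin n → ℝ)) :
    tensorMap (bilinTensor B) = B :=
  bilin_ext fun i j => tensorMap_single _ i j

theorem tensorMap_add (C C' : Fin n → Fin n → Fin n → ℝ) :
    tensorMap (C + C') = tensorMap C + tensorMap C' :=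
  bilin_ext fun i j => by simp [tensorMap_single]

theorem tensorMap_smul (r : ℝ) (C : Fin n → Fin n → Fin n → ℝ) :
    tensorMap (r • C) = r • tensorMap C :=
  bilin_ext fun i j => by simp [tensorMap_single]

theorem ContDiff.tensorMap {V : Type*} [NormedAddCommGroup V] [NormedSpace ℝ V]
    {C : V → Fin n → Fin n → Fin n → ℝ} {x y : V → Fin n → ℝ} {m : WithTop ℕ∞}
    (hC : ContDiff ℝ m C) (hx : ContDiff ℝ m x) (hy : ContDiff ℝ m y) :
    ContDiff ℝ m fun v => tensorMap (C v) (x v) (y v) := by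
  refine contDiff_pi.2 fun k => ?_
  simp only [tensorMap_apply]
  fun_prop

end Bilinear

/-- The derivative along a line on which the function is a cubic polynomial. -/
theorem fderiv_apply_of_cubic {V F : Type*} [NormedAddCommGroup V] [NormedSpace ℝ V]
    [NormedAddCommGroup F] [NormedSpace ℝ F] {f : V → F} {a v : V} {u q r : F}
    (hf : DifferentiableAt ℝ f a)
    (h : ∀ t : ℝ, f (a + t • v) = f a + t • u + t ^ 2 • q + t ^ 3 • r) :
    fderiv ℝ f a v = u := by
  have h₁ : HasDerivAt (fun t : ℝ => f (a + t • v)) (fderiv ℝ f a v) 0 := by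
    have hl : HasDerivAt (fun t : ℝ => a + t • v) v 0 := by
      simpa using ((hasDerivAt_id (0 : ℝ)).smul_const v).const_add a
    have hf' : HasFDerivAt f (fderiv ℝ f a) (a + (0 : ℝ) • v) := by
      simpa using hf.hasFDerivAt
    exact hf'.comp_hasDerivAt 0 hl
  have h₂ : HasDerivAt (fun t : ℝ => f a + t • u + t ^ 2 • q + t ^ 3 • r) u 0 := by
    have := ((((hasDerivAt_id (0 : ℝ)).smul_const u).const_add (f a)).add
      ((hasDerivAt_pow 2 (0 : ℝ)).smul_const q)).add ((hasDerivAt_pow 3 (0 : ℝ)).smul_const r)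
    simpa using! this
  simp only [h] at h₁
  exact h₁.unique h₂

/-! ### Linearization of the law equations and of the deformation map. -/

section Rigidity

variable {n : ℕ}

/-- The Jacobi expression of a bilinear map. -/
def jacobiator (C : Fin n → Fin n → Fin n → ℝ) (x y z : Fin n → ℝ) : Fin n → ℝ :=
  tensorMap C x (tensorMap C y z) + tensorMap C y (tensorMap C z x) +
    tensorMap C z (tensorMap C x y)

/-- The equations of the variety of Lie algebra laws. -/
def lawEquations (C : Fin n → Fin n → Fin n → ℝ) :
    (Fin n → Fin n → Fin n → ℝ) × (Fin n → Fin n → Fin n → Fin n → ℝ) :=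
  (fun i j => C i j + C j i,
    fun i j k => jacobiator C (Pi.single i 1) (Pi.single j 1) (Pi.single k 1))

theorem contDiff_lawEquations {m : WithTop ℕ∞} : ContDiff ℝ m (lawEquations (n := n)) := by
  refine ContDiff.prodMk (by fun_prop) ?_
  refine contDiff_pi.2 fun i => contDiff_pi.2 fun j => contDiff_pi.2 fun k => ?_
  have h : ∀ x y z : Fin n → ℝ, ContDiff ℝ m
      fun C : Fin n → Fin n → Fin n → ℝ => tensorMap C x (tensorMap C y z) := fun x y z =>
    contDiff_id.tensorMap contDiff_const (contDiff_id.tensorMap contDiff_const contDiff_const)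
  exact ((h _ _ _).add (h _ _ _)).add (h _ _ _)

/-- The linearization of the Jacobi expression. -/
def jacobiatorDeriv (C w : Fin n → Fin n → Fin n → ℝ) (x y z : Fin n → ℝ) : Fin n → ℝ :=
  (tensorMap C x (tensorMap w y z) + tensorMap C y (tensorMap w z x) +
    tensorMap C z (tensorMap w x y)) +
  (tensorMap w x (tensorMap C y z) + tensorMap w y (tensorMap C z x) +
    tensorMap w z (tensorMap C x y))

/-- Antisymmetry is a linear condition and the Jacobi expression is quadratic, so along a line the
coefficient of `t` is the polarization and that of `t²` is the Jacobi expression of `w`. -/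
theorem fderiv_lawEquations (C w : Fin n → Fin n → Fin n → ℝ) :
    fderiv ℝ lawEquations C w = (fun i j => w i j + w j i,
      fun i j k => jacobiatorDeriv C w (Pi.single i 1) (Pi.single j 1) (Pi.single k 1)) := by
  refine fderiv_apply_of_cubic (q := (0, (lawEquations w).2)) (r := 0)
    ((contDiff_lawEquations (m := 1)).differentiable (by simp) _) fun t => ?_
  refine Prod.ext ?_ ?_
  · funext i j
    simp only [lawEquations, Prod.fst_add, Prod.smul_fst, Pi.add_apply, Pi.smul_apply,
      smul_zero, Prod.fst_zero, Pi.zero_apply]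
    module
  · funext i j k
    simp only [lawEquations, Prod.snd_add, Prod.smul_snd, Pi.add_apply, Pi.smul_apply,
      smul_zero, Prod.snd_zero, Pi.zero_apply, jacobiator, jacobiatorDeriv, tensorMap_add,
      tensorMap_smul, LinearMap.add_apply, LinearMap.smul_apply, map_add, map_smul]
    module

/-- A tensor solving the linearized equations of the variety of laws is a 2-cocycle. -/
theorem exists_twoCocycle_of_fderiv_lawEquations (μ : LieLaw n) {w : Fin n → Fin n → Fin n → ℝ}
    (hw : fderiv ℝ lawEquations μ.1 w = 0) :
    ∃ φ ∈ twoCocycle ℝ μ.Alg μ.Alg, ∀ x y, φ x y = tensorMap w x y := by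
  rw [fderiv_lawEquations, Prod.mk_eq_zero] at hw
  obtain ⟨h₁, h₂⟩ := hw
  have hskew : ∀ x y, tensorMap w x y = -tensorMap w y x := by
    have : tensorMap w = -(tensorMap w).flip := bilin_ext fun i j => by
      have := congrFun (congrFun h₁ i) j
      simpa [tensorMap_single] using! eq_neg_of_add_eq_zero_left this
    intro x y
    exact LinearMap.congr_fun (LinearMap.congr_fun this x) y
  have halt : ∀ x, tensorMap w x x = 0 := fun x => self_eq_neg.1 (hskew x x)
  let φ : twoCochain ℝ μ.Alg μ.Alg :=
    ⟨(tensorMap w : (Fin n → ℝ) →ₗ[ℝ] (Fin n → ℝ) →ₗ[ℝ] (Fin n → ℝ)), halt⟩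
  have key : ∀ x y z : Fin n → ℝ, jacobiatorDeriv μ.1 w x y z = 0 →
      μ.bracket x (tensorMap w y z) - μ.bracket y (tensorMap w x z) +
      μ.bracket z (tensorMap w x y) - tensorMap w (μ.bracket x y) z +
      tensorMap w (μ.bracket x z) y - tensorMap w (μ.bracket y z) x = 0 := by
    intro x y z hJ
    have hJ' : (μ.bracket x (tensorMap w y z) + μ.bracket y (tensorMap w z x) +
      μ.bracket z (tensorMap w x y)) + (tensorMap w x (μ.bracket y z) +
      tensorMap w y (μ.bracket z x) + tensorMap w z (μ.bracket x y)) = 0 := hJ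
    rw [hskew z x, hskew x (μ.bracket y z), hskew y (μ.bracket z x), hskew z (μ.bracket x y),
      μ.bracket_skew z x] at hJ'
    rw [← hJ']
    simp only [map_neg, LinearMap.neg_apply]
    abel
  refine ⟨φ, ?_, fun x y => rfl⟩
  rw [mem_twoCocycle_iff]
  let b : Module.Basis (Fin n) ℝ μ.Alg := Pi.basisFun ℝ (Fin n)
  have hb : ∀ i, b i = (Pi.single i 1 : Fin n → ℝ) := fun i => Pi.basisFun_apply ℝ (Fin n) i
  refine b.ext fun i => b.ext fun j => b.ext fun k => key (b i) (b j) (b k) ?_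
  rw [hb, hb, hb]
  exact congrFun (congrFun (congrFun h₂ i) j) k

/-- The defect of `1 + X` as an isomorphism from the algebra with law `C` to the algebra with law
`C₀ + w`. -/
def isoDefect (C₀ : Fin n → Fin n → Fin n → ℝ) (X : (Fin n → ℝ) →L[ℝ] (Fin n → ℝ))
    (w C : Fin n → Fin n → Fin n → ℝ) (i j : Fin n) : Fin n → ℝ :=
  (C i j + X (C i j)) - tensorMap (C₀ + w) (Pi.single i 1 + X (Pi.single i 1))
    (Pi.single j 1 + X (Pi.single j 1))

/-- The graph of `isoDefect` over the space of laws. -/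
def isoDefectGraph (C₀ : Fin n → Fin n → Fin n → ℝ) (W : Submodule ℝ (Fin n → Fin n → Fin n → ℝ))
    (p : ((Fin n → ℝ) →L[ℝ] (Fin n → ℝ)) × W × (Fin n → Fin n → Fin n → ℝ)) :
    (Fin n → Fin n → Fin n → ℝ) × (Fin n → Fin n → Fin n → ℝ) :=
  (isoDefect C₀ p.1 p.2.1 p.2.2, p.2.2)

theorem contDiff_isoDefectGraph {m : WithTop ℕ∞} (C₀ : Fin n → Fin n → Fin n → ℝ)
    (W : Submodule ℝ (Fin n → Fin n → Fin n → ℝ)) : ContDiff ℝ m (isoDefectGraph C₀ W) := by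
  refine ContDiff.prodMk ?_ (by fun_prop)
  refine contDiff_pi.2 fun i => contDiff_pi.2 fun j => ?_
  have hsub : ContDiff ℝ m (fun w : W => (w : Fin n → Fin n → Fin n → ℝ)) :=
    W.subtypeL.contDiff
  refine ContDiff.sub (by fun_prop) (ContDiff.tensorMap ?_ (by fun_prop) (by fun_prop))
  exact contDiff_const.add (hsub.comp (by fun_prop))

/-- When `C₀` is a law, the terms in `X` add up to minus the coboundary of `X`. The first component
of the derivative is thus `η - dX - w`, which is what ties surjectivity to the cohomology. -/
theorem fderiv_isoDefectGraph (C₀ : Fin n → Fin n → Fin n → ℝ)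
    (W : Submodule ℝ (Fin n → Fin n → Fin n → ℝ)) (X : (Fin n → ℝ) →L[ℝ] (Fin n → ℝ)) (w : W)
    (η : Fin n → Fin n → Fin n → ℝ) :
    fderiv ℝ (isoDefectGraph C₀ W) (0, 0, C₀) (X, w, η) =
      (fun i j => η i j + X (C₀ i j) - tensorMap C₀ (X (Pi.single i 1)) (Pi.single j 1) -
        tensorMap C₀ (Pi.single i 1) (X (Pi.single j 1)) - (w : Fin n → Fin n → Fin n → ℝ) i j,
        η) := by
  refine fderiv_apply_of_cubic
    (q := (fun i j => X (η i j) - tensorMap C₀ (X (Pi.single i 1)) (X (Pi.single j 1)) -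
      tensorMap w (X (Pi.single i 1)) (Pi.single j 1) -
      tensorMap w (Pi.single i 1) (X (Pi.single j 1)), 0))
    (r := (fun i j => -tensorMap w (X (Pi.single i 1)) (X (Pi.single j 1)), 0))
    ((contDiff_isoDefectGraph (m := 1) C₀ W).differentiable (by simp) _) fun t => ?_
  refine Prod.ext ?_ ?_
  · funext i j
    simp only [isoDefectGraph, isoDefect, Prod.fst_add, Prod.snd_add, Prod.smul_fst,
      Prod.smul_snd, Pi.add_apply, Pi.smul_apply, zero_add, tensorMap_add, tensorMap_smul,
      LinearMap.add_apply, LinearMap.smul_apply, map_add, map_smul, zero_apply,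
      smul_apply, tensorMap_single, Submodule.coe_smul, Submodule.coe_zero,
      add_zero]
    module
  · simp [isoDefectGraph]

end Rigidity

/-! ### Vanishing of the second cohomology implies stability. -/

section Openness

open Filter Topology

variable {n : ℕ}

/-- If the second adjoint cohomology vanishes, the derivative of the family of deformations
`(1 + X)⁻¹ · (μ + w)`, with `w` in a complement of the cocycles, is surjective. -/
theorem range_fderiv_isoDefectGraph (μ : LieLaw n)
    (h : ∀ φ ∈ twoCocycle ℝ μ.Alg μ.Alg, ∃ f, d₁₂ ℝ μ.Alg μ.Alg f = φ)
    {W : Submodule ℝ (Fin n → Fin n → Fin n → ℝ)}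
    (hW : IsCompl (LinearMap.ker (fderiv ℝ lawEquations μ.1).toLinearMap) W) :
    (fderiv ℝ (isoDefectGraph μ.1 W) (0, 0, μ.1)).range = ⊤ := by
  rw [LinearMap.range_eq_top]
  rintro ⟨ξ, η⟩
  -- `η - ξ` splits into a solution `z` of the linearized equations and an element of `W`. Since `z
  -- = dX` for some `X`, the first component at `(X, w, η)` is `η - z - w = ξ`.
  obtain ⟨z, hz, w, hw, hzw⟩ := Submodule.mem_sup.1
    (hW.sup_eq_top ▸ Submodule.mem_top : η - ξ ∈ _)
  obtain ⟨φ, hφ, hφz⟩ := exists_twoCocycle_of_fderiv_lawEquations μ hz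
  obtain ⟨f, rfl⟩ := h φ hφ
  let X : (Fin n → ℝ) →L[ℝ] (Fin n → ℝ) :=
    LinearMap.toContinuousLinearMap (f : (Fin n → ℝ) →ₗ[ℝ] (Fin n → ℝ))
  refine ⟨(X, ⟨w, hw⟩, η), ?_⟩
  change fderiv ℝ (isoDefectGraph μ.1 W) (0, 0, μ.1) (X, ⟨w, hw⟩, η) = (ξ, η)
  rw [fderiv_isoDefectGraph]
  refine Prod.ext ?_ rfl
  funext i j
  have h₁ : tensorMap μ.1 (Pi.single i 1) (X (Pi.single j 1)) -
      tensorMap μ.1 (Pi.single j 1) (X (Pi.single i 1)) - X (tensorMap μ.1 (Pi.single i 1)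
        (Pi.single j 1)) = tensorMap z (Pi.single i 1) (Pi.single j 1) :=
    hφz (Pi.single i 1 : Fin n → ℝ) (Pi.single j 1 : Fin n → ℝ)
  have h₂ : tensorMap μ.1 (X (Pi.single i 1)) (Pi.single j 1) =
      -tensorMap μ.1 (Pi.single j 1) (X (Pi.single i 1)) := μ.bracket_skew _ _
  have h₃ : z i j + w i j = η i j - ξ i j := congrFun (congrFun hzw i) j
  rw [tensorMap_single, tensorMap_single] at h₁
  simp only
  rw [h₂]
  have h₄ : ξ i j = η i j - (z i j + w i j) := by rw [h₃]; abel
  rw [h₄, ← h₁]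
  abel

theorem lawEquations_eq_zero {C : Fin n → Fin n → Fin n → ℝ} (h₁ : ∀ x, tensorMap C x x = 0)
    (h₂ : ∀ x y z, jacobiator C x y z = 0) : lawEquations C = 0 := by
  refine Prod.ext ?_ ?_
  · funext i j
    have h := h₁ (Pi.single i 1 + Pi.single j 1)
    simp only [map_add, LinearMap.add_apply, h₁, zero_add, add_zero, tensorMap_single] at h
    exact (add_comm _ _).trans h
  · funext i j k
    exact h₂ _ _ _

/-- If the second adjoint cohomology vanishes, all laws near the given one are isomorphic to it. -/
theorem LieLaw.orbit_mem_nhds (μ : LieLaw n)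
    (h : ∀ φ ∈ twoCocycle ℝ μ.Alg μ.Alg, ∃ f, d₁₂ ℝ μ.Alg μ.Alg f = φ) : μ.orbit ∈ 𝓝 μ := by
  obtain ⟨W, hW⟩ := Submodule.exists_isCompl
    (LinearMap.ker (fderiv ℝ lawEquations μ.1).toLinearMap)
  -- `μ` is an isolated law in the slice `μ + W`: the derivative of the law equations is injective
  -- on `W`, and in finite dimension it is then bounded below.
  have hlaw : ∀ᶠ w : W in 𝓝 0,
      lawEquations (μ.1 + (w : Fin n → Fin n → Fin n → ℝ)) = 0 → w = 0 := by
    have hd : HasFDerivAt (fun w : W => lawEquations (μ.1 + (w : Fin n → Fin n → Fin n → ℝ)))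
        ((fderiv ℝ lawEquations μ.1).comp W.subtypeL) 0 := by
      have h₁ : HasFDerivAt (fun w : W => μ.1 + (w : Fin n → Fin n → Fin n → ℝ)) W.subtypeL 0 :=
        W.subtypeL.hasFDerivAt.const_add μ.1
      have h₂ : HasFDerivAt lawEquations (fderiv ℝ lawEquations μ.1)
          (μ.1 + ((0 : W) : Fin n → Fin n → Fin n → ℝ)) := by
        rw [Submodule.coe_zero, add_zero]
        exact ((contDiff_lawEquations (m := 1)).differentiable (by simp) _).hasFDerivAt
      exact HasFDerivAt.comp (f := fun w : W => μ.1 + (w : Fin n → Fin n → Fin n → ℝ)) 0 h₂ h₁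
    have hinj : LinearMap.ker
        ((fderiv ℝ lawEquations μ.1).comp W.subtypeL).toLinearMap = ⊥ := by
      rw [LinearMap.ker_eq_bot']
      intro w hw
      exact Subtype.ext ((Submodule.disjoint_def.1 hW.disjoint) _ hw w.2)
    obtain ⟨K, -, hK⟩ := LinearMap.exists_antilipschitzWith _ hinj
    have := hd.eventually_ne (c := 0) ⟨K, hK⟩
    filter_upwards [eventually_nhdsWithin_iff.1 this] with w hw h0
    by_contra hne
    exact hw hne h0
  have hunit : ∀ᶠ X : (Fin n → ℝ) →L[ℝ] (Fin n → ℝ) in 𝓝 0, IsUnit (1 + X) := by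
    have : Tendsto (fun X : (Fin n → ℝ) →L[ℝ] (Fin n → ℝ) => 1 + X) (𝓝 0) (𝓝 1) :=
      Continuous.tendsto' (by fun_prop) _ _ (add_zero 1)
    exact this.eventually (Units.isOpen.mem_nhds isUnit_one)
  -- A map with surjective derivative is locally open. As `C` is also a component of the value,
  -- every `(0, C)` with `C` near `μ` is attained with small `X` and `w`.
  have hmap : map (isoDefectGraph μ.1 W) (𝓝 (0, 0, μ.1)) =
      𝓝 (isoDefectGraph μ.1 W (0, 0, μ.1)) :=
    ((contDiff_isoDefectGraph (m := 1) μ.1 W).contDiffAt.hasStrictFDerivAt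
      (by simp)).map_nhds_eq_of_surj (range_fderiv_isoDefectGraph μ h hW)
  have h0 : isoDefectGraph μ.1 W (0, 0, μ.1) = (0, μ.1) := by
    refine Prod.ext ?_ rfl
    funext i j
    simp [isoDefectGraph, isoDefect, tensorMap_single]
  have hev : ∀ᶠ p : ((Fin n → ℝ) →L[ℝ] (Fin n → ℝ)) × W × (Fin n → Fin n → Fin n → ℝ) in
      𝓝 (0, 0, μ.1), IsUnit (1 + p.1) ∧
      (lawEquations (μ.1 + ((p.2.1 : W) : Fin n → Fin n → Fin n → ℝ)) = 0 → p.2.1 = 0) := by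
    have e₁ : Tendsto (fun p : ((Fin n → ℝ) →L[ℝ] (Fin n → ℝ)) × W ×
        (Fin n → Fin n → Fin n → ℝ) => p.1) (𝓝 (0, 0, μ.1)) (𝓝 0) := continuous_fst.tendsto _
    have e₂ : Tendsto (fun p : ((Fin n → ℝ) →L[ℝ] (Fin n → ℝ)) × W ×
        (Fin n → Fin n → Fin n → ℝ) => p.2.1) (𝓝 (0, 0, μ.1)) (𝓝 0) :=
      (continuous_fst.comp continuous_snd).tendsto _
    exact (e₁.eventually hunit).and (e₂.eventually hlaw)
  have himage := image_mem_map (m := isoDefectGraph μ.1 W) hev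
  rw [hmap, h0] at himage
  have hcont : Tendsto (fun ν : LieLaw n => ((0 : Fin n → Fin n → Fin n → ℝ), ν.1)) (𝓝 μ)
      (𝓝 (0, μ.1)) :=
    (Continuous.prodMk continuous_const continuous_subtype_val).tendsto μ
  filter_upwards [hcont himage] with ν hν
  obtain ⟨⟨X, w, C⟩, ⟨hX, hw⟩, hp⟩ := hν
  obtain ⟨hdef, rfl⟩ := Prod.ext_iff.1 hp
  obtain ⟨u, hu⟩ := hX
  let g : (Fin n → ℝ) ≃L[ℝ] (Fin n → ℝ) := ContinuousLinearEquiv.ofUnit u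
  have hg : ∀ x, g x = x + X x := fun x => by
    change (u : (Fin n → ℝ) →L[ℝ] (Fin n → ℝ)) x = _
    rw [hu]; rfl
  have hiso : ∀ x y, g (tensorMap ν.1 x y) = tensorMap (μ.1 + w.1) (g x) (g y) := by
    have := bilin_ext (B := (tensorMap ν.1).compr₂ g.toLinearEquiv.toLinearMap)
      (B' := (tensorMap (μ.1 + w.1)).compl₁₂ g.toLinearEquiv.toLinearMap
        g.toLinearEquiv.toLinearMap) fun i j => by
        have := congrFun (congrFun hdef i) j
        change g (tensorMap ν.1 _ _) = tensorMap (μ.1 + w.1) (g _) (g _)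
        rw [hg, hg, hg, tensorMap_single]
        exact sub_eq_zero.1 this
    intro x y
    exact LinearMap.congr_fun (LinearMap.congr_fun this x) y
  have hiso' : ∀ x y, tensorMap (μ.1 + w.1) x y = g (tensorMap ν.1 (g.symm x) (g.symm y)) := by
    intro x y
    rw [hiso]; simp
  -- `μ + w` is the image of the law `ν` under `g`, hence a law, and isolation in the slice applies.
  have hw0 : w = 0 := by
    refine hw (lawEquations_eq_zero (fun x => ?_) fun x y z => ?_)
    · rw [hiso', ν.2.1]; simp
    · simp only [jacobiator, hiso', ContinuousLinearEquiv.symm_apply_apply, ← map_add, ν.2.2]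
      simp
  refine ⟨g.symm.toLinearEquiv, fun x y => ?_⟩
  subst hw0
  rw [Submodule.coe_zero, add_zero] at hiso
  change tensorMap ν.1 x y = g.symm (tensorMap μ.1 (g x) (g y))
  rw [← hiso]; simp

/-- The law obtained from `μ` by a change of coordinates. -/
def LieLaw.transport (g : (Fin n → ℝ) ≃ₗ[ℝ] (Fin n → ℝ)) (μ : LieLaw n) : LieLaw n :=
  ⟨bilinTensor ((μ.bracket.compl₁₂ g.symm.toLinearMap g.symm.toLinearMap).compr₂ g.toLinearMap),
    fun x => by
      rw [tensorMap_bilinTensor]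
      simpa using! μ.2.1 (g.symm x),
    fun x y z => by
      rw [tensorMap_bilinTensor]
      have := congrArg g (μ.2.2 (g.symm x) (g.symm y) (g.symm z))
      simpa using! this⟩

theorem LieLaw.transport_bracket (g : (Fin n → ℝ) ≃ₗ[ℝ] (Fin n → ℝ)) (μ : LieLaw n)
    (x y : Fin n → ℝ) : (μ.transport g).bracket x y = g (μ.bracket (g.symm x) (g.symm y)) := by
  change tensorMap (bilinTensor _) x y = _
  rw [tensorMap_bilinTensor]; rfl

theorem LieLaw.continuous_transport (g : (Fin n → ℝ) ≃ₗ[ℝ] (Fin n → ℝ)) :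
    Continuous (LieLaw.transport g) := by
  refine Continuous.subtype_mk ?_ _
  refine continuous_pi fun i => continuous_pi fun j => ?_
  have hg : Continuous g := g.toLinearMap.continuous_of_finiteDimensional
  refine hg.comp (continuous_pi fun k => ?_)
  change Continuous fun μ : LieLaw n => tensorMap μ.1 (g.symm (Pi.single i 1))
    (g.symm (Pi.single j 1)) k
  simp only [tensorMap_apply]
  have h : ∀ i j k, Continuous fun μ : LieLaw n => μ.1 i j k := fun i j k =>
    have h : Continuous fun C : Fin n → Fin n → Fin n → ℝ => C i j k := by fun_prop
    h.comp continuous_subtype_val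
  exact continuous_finsetSum _ fun i' _ => continuous_finsetSum _ fun j' _ =>
    ((h i' j' k).mul continuous_const).mul continuous_const

/-- A Lie algebra whose second adjoint cohomology vanishes is stable. -/
theorem LieLaw.isStable_of_subsingleton_adjointH2 (μ : LieLaw n)
    (h : Subsingleton (AdjointH2 μ.Alg)) : μ.IsStable := by
  rw [subsingleton_adjointH2_iff] at h
  refine isOpen_iff_mem_nhds.2 fun ν hν => ?_
  obtain ⟨g, hg⟩ := hν
  have hνμ : ν.transport g.symm = μ := by
    refine Subtype.ext (funext fun i => funext fun j => ?_)
    have := LieLaw.transport_bracket g.symm ν (Pi.single i 1) (Pi.single j 1)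
    simp only [hg, LinearEquiv.symm_symm, LinearEquiv.symm_apply_apply] at this
    simpa [LieLaw.bracket, tensorMap_single] using! this
  -- The neighbourhood of `μ` inside its orbit is pulled back to the other points of the orbit by
  -- the continuous action of the linear group.
  have hmem : LieLaw.transport g.symm ⁻¹' μ.orbit ∈ 𝓝 ν :=
    (LieLaw.continuous_transport g.symm).continuousAt
      (by rw [hνμ]; exact μ.orbit_mem_nhds h)
  filter_upwards [hmem] with τ hτ
  obtain ⟨g', hg'⟩ := hτ
  refine ⟨g'.trans g, fun x y => ?_⟩
  have := hg' (g.symm x) (g.symm y)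
  rw [LieLaw.transport_bracket] at this
  simp only [LinearEquiv.symm_symm, LinearEquiv.apply_symm_apply] at this
  simp [← this]

end Openness

/-! ### The equations of harmonic cocycles in the standard basis. -/

section Coordinates

variable {n : ℕ}

/-- The standard basis of the Lie algebra `(ℝⁿ, μ)`. -/
def LieLaw.basis (μ : LieLaw n) : Module.Basis (Fin n) ℝ μ.Alg := Pi.basisFun ℝ (Fin n)

/-- The coordinates of a 2-cochain in the standard basis. -/
def LieLaw.coeff (μ : LieLaw n) (φ : twoCochain ℝ μ.Alg μ.Alg) : Fin n → Fin n → Fin n → ℝ :=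
  cochainCoeff μ.basis φ

variable {μ : LieLaw n} {w : Fin n → ℝ} {ψ : twoCochain ℝ μ.Alg μ.Alg}

theorem LieLaw.basis_apply (i : Fin n) : μ.basis i = (Pi.single i 1 : Fin n → ℝ) :=
  Pi.basisFun_apply ℝ (Fin n) i

theorem LieLaw.repr_lie (i : Fin n) (x : Fin n → ℝ) (k : Fin n) :
    μ.basis.repr ⁅μ.basis i, (x : μ.Alg)⁆ k = μ.bracket (Pi.single i 1) x k := by
  rw [LieLaw.basis_apply]; rfl

theorem LieLaw.structureConst_basis (i j k : Fin n) : structureConst μ.basis i j k = μ.1 i j k := by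
  rw [structureConst, LieLaw.basis_apply j, LieLaw.repr_lie, LieLaw.bracket, tensorMap_single]

theorem LieLaw.coeff_skew (φ : twoCochain ℝ μ.Alg μ.Alg) (i j k : Fin n) :
    μ.coeff φ i j k = -μ.coeff φ j i k := cochainCoeff_skew μ.basis φ i j k

theorem LieLaw.coeff_self (φ : twoCochain ℝ μ.Alg μ.Alg) (i k : Fin n) :
    μ.coeff φ i i k = 0 := self_eq_neg.1 (LieLaw.coeff_skew φ i i k)

theorem LieLaw.bracket_single_apply (i : Fin n) (x : Fin n → ℝ) (k : Fin n) :
    μ.bracket (Pi.single i 1) x k = ∑ m, μ.1 i m k * x m := by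
  simp [LieLaw.bracket, tensorMap_apply, Pi.single_apply]

theorem LieLaw.bracket_single_single (i j k : Fin n) :
    μ.bracket (Pi.single i 1) (Pi.single j 1) k = μ.1 i j k :=
  congrFun (tensorMap_single _ _ _) k

/-- The cocycle equations in coordinates. -/
theorem IsHarmonic.coeff_cocycle (hψ : IsHarmonic μ.basis w ψ) (i j l k : Fin n) :
    μ.bracket (Pi.single i 1) (μ.coeff ψ j l) k - μ.bracket (Pi.single j 1) (μ.coeff ψ i l) k +
      μ.bracket (Pi.single l 1) (μ.coeff ψ i j) k -
      ∑ m, μ.bracket (Pi.single i 1) (Pi.single j 1) m * μ.coeff ψ m l k +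
      ∑ m, μ.bracket (Pi.single i 1) (Pi.single l 1) m * μ.coeff ψ m j k -
      ∑ m, μ.bracket (Pi.single j 1) (Pi.single l 1) m * μ.coeff ψ m i k = 0 := by
  have h := cochainCoeff_twoCocycle μ.basis hψ.mem_twoCocycle i j l k
  simp only [LieLaw.structureConst_basis, Finset.sum_sub_distrib, Finset.sum_add_distrib] at h
  simp only [LieLaw.bracket_single_single]
  simpa only [LieLaw.bracket_single_apply] using! h

/-- A harmonic cocycle is invariant under `X_a` if the adjoint of `ad X_a` for the metric `diag w`
is a multiple of some `ad X_b`. -/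
theorem IsHarmonic.bracket_coeff (hψ : IsHarmonic μ.basis w ψ) (hw : ∀ i, 0 < w i)
    (a b : Fin n) (ε : ℝ) (hab : ∀ i k, w k * μ.bracket (Pi.single a 1) (Pi.single i 1) k =
      w i * (ε * μ.bracket (Pi.single b 1) (Pi.single k 1) i)) (i j k : Fin n) :
    μ.bracket (Pi.single a 1) (μ.coeff ψ i j) k =
      ∑ m, μ.bracket (Pi.single a 1) (Pi.single i 1) m * μ.coeff ψ m j k +
      ∑ m, μ.bracket (Pi.single a 1) (Pi.single j 1) m * μ.coeff ψ i m k := by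
  have hrepr : ∀ a i k, μ.basis.repr ⁅μ.basis a, μ.basis i⁆ k =
      μ.bracket (Pi.single a 1) (Pi.single i 1) k := fun a i k => by
    rw [LieLaw.basis_apply i, LieLaw.repr_lie]
  have h := hψ.tensorAction_eq_zero hw (y := μ.basis a) (x := ε • μ.basis b) fun i k => by
    rw [hrepr, smul_lie, map_smul, Finsupp.smul_apply, hrepr]
    exact hab i k
  have h := congrFun (congrFun (congrFun h i) j) k
  simp only [tensorAction, hrepr, Finset.sum_sub_distrib, Pi.zero_apply] at h
  rw [LieLaw.bracket_single_apply]
  simp only [← LieLaw.bracket_single_single (μ := μ)]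
  change _ - ∑ m, _ * μ.coeff ψ m j k - ∑ m, _ * μ.coeff ψ i m k = 0 at h
  rw [sub_sub, sub_eq_zero] at h
  exact h

/-- The invariance equations, with `A` and `B` the matrix of `ad X_a` and its transpose, and `A'` the
matrix of `ad X_b`. -/
theorem IsHarmonic.coeff_invariant (hψ : IsHarmonic μ.basis w ψ) (hw : ∀ i, 0 < w i)
    {a b : Fin n} (ε : ℝ) {A A' B : (Fin n → ℝ) → Fin n → ℝ}
    (hA : ∀ x, μ.bracket (Pi.single a 1) x = A x) (hA' : ∀ x, μ.bracket (Pi.single b 1) x = A' x)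
    (hB : ∀ x i, ∑ m, A (Pi.single i 1) m * x m = B x i)
    (hAB : ∀ x i, B (fun m => w m * x m) i = w i * (ε * A' x i)) (i j k : Fin n) :
    A (μ.coeff ψ i j) k = B (fun m => μ.coeff ψ m j k) i + B (fun m => μ.coeff ψ i m k) j := by
  have h := hψ.bracket_coeff hw a b ε (fun i k => by
    rw [hA, hA', ← hAB, ← hB]
    simp [Pi.single_apply, mul_comm]) i j k
  simpa only [hA, hB] using h

/-- The coordinates of a harmonic cocycle have weight zero for every diagonal `ad X_a`. -/
theorem IsHarmonic.coeff_weight (hψ : IsHarmonic μ.basis w ψ) (hw : ∀ i, 0 < w i) (a : Fin n)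
    {wt : Fin n → ℝ} (ha : ∀ x k, μ.bracket (Pi.single a 1) x k = wt k * x k)
    {i j k : Fin n} (hne : wt k ≠ wt i + wt j) : μ.coeff ψ i j k = 0 := by
  -- A diagonal operator is self-adjoint for every diagonal form.
  have h := hψ.bracket_coeff hw a a 1 (fun i k => by
    rw [ha, ha]
    by_cases hik : i = k
    · subst hik; ring
    · simp [Pi.single_eq_of_ne, hik, Ne.symm hik]) i j k
  simp only [ha, Pi.single_apply, mul_ite, mul_one, mul_zero, ite_mul, zero_mul,
    Finset.sum_ite_eq', Finset.mem_univ, if_true] at h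
  have h' : (wt k - (wt i + wt j)) * μ.coeff ψ i j k = 0 := by linear_combination h
  exact (mul_eq_zero.1 h').resolve_left (sub_ne_zero.2 hne)

/-- Integer weights allow the list of entries of weight zero to be checked by `decide`. -/
theorem IsHarmonic.coeff_intWeight (hψ : IsHarmonic μ.basis w ψ) (hw : ∀ i, 0 < w i) (a : Fin n)
    (wt : Fin n → ℤ) (ha : ∀ x k, μ.bracket (Pi.single a 1) x k = wt k * x k)
    (i j k : Fin n) (hne : wt k ≠ wt i + wt j) : μ.coeff ψ i j k = 0 :=
  hψ.coeff_weight hw a (wt := fun k => wt k) ha (by exact_mod_cast hne)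

/-- A harmonic cocycle is orthogonal to the coboundary of the endomorphism `diag f`. -/
theorem IsHarmonic.coeff_orthogonal (hψ : IsHarmonic μ.basis w ψ) (f : Fin n → ℝ) :
    ∑ i, ∑ j, ∑ k, (w k / (w i * w j) * (f i + f j - f k) * μ.coeff ψ i j k) * μ.1 i j k = 0 := by
  let F : oneCochain ℝ μ.Alg μ.Alg :=
    (LinearMap.pi fun k => f k • LinearMap.proj k : (Fin n → ℝ) →ₗ[ℝ] (Fin n → ℝ))
  have hF : ∀ j m, μ.basis.repr (F (μ.basis j)) m = if m = j then f j else 0 := fun j m => by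
    rw [LieLaw.basis_apply]
    change f m * (Pi.single j 1 : Fin n → ℝ) m = _
    by_cases h : m = j
    · subst h; simp
    · simp [h]
  rw [← hψ.orthogonal F, tensorForm]
  refine Finset.sum_congr rfl fun i _ => Finset.sum_congr rfl fun j _ =>
    Finset.sum_congr rfl fun k _ => ?_
  have : cochainCoeff μ.basis (d₁₂ ℝ μ.Alg μ.Alg F) i j k = (f i + f j - f k) * μ.1 i j k := by
    rw [cochainCoeff_d₁₂]
    simp only [hF, LieLaw.structureConst_basis, mul_ite, mul_zero, Finset.sum_sub_distrib,
      Finset.sum_ite_eq', Finset.sum_ite_eq, Finset.mem_univ, if_true]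
    have : μ.1 j i k = -μ.1 i j k := by
      have := congrFun (μ.bracket_skew (Pi.single j 1) (Pi.single i 1)) k
      simpa only [Pi.neg_apply, LieLaw.bracket_single_single] using this
    rw [this]; ring
  rw [this]
  change _ = _ * (μ.coeff ψ i j k * _)
  ring

/-- Only the listed structure constants contribute, so each orthogonality relation becomes a short
explicit sum. -/
theorem sum_mul_tableTensor (l : List (ℕ × ℕ × ℕ × ℝ)) (G : Fin n → Fin n → Fin n → ℝ) :
    ∑ i, ∑ j, ∑ k, G i j k * tableTensor l i j k = (l.map fun e => e.2.2.2 *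
      (coord (fun i => coord (fun j => coord (G i j) e.2.2.1) e.2.1) e.1 -
        coord (fun i => coord (fun j => coord (G i j) e.2.2.1) e.1) e.2.1)).sum := by
  have hpt : ∀ (a b c : ℕ) (v : ℝ), ∑ i : Fin n, ∑ j : Fin n, ∑ k : Fin n,
      G i j k * (if i.val + 1 = a ∧ j.val + 1 = b ∧ k.val + 1 = c then v else 0) =
      v * coord (fun i => coord (fun j => coord (G i j) c) b) a := fun a b c v => by
    rw [coord, Finset.mul_sum]
    refine Finset.sum_congr rfl fun i _ => ?_
    by_cases hi : i.val + 1 = a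
    · rw [if_pos hi, coord, Finset.mul_sum]
      refine Finset.sum_congr rfl fun j _ => ?_
      by_cases hj : j.val + 1 = b
      · rw [if_pos hj, coord, Finset.mul_sum]
        simp only [hi, hj, true_and, mul_ite, mul_zero, mul_comm]
      · simp [hj]
    · simp [hi]
  induction l with
  | nil => simp [tableTensor]
  | cons e l ih =>
    have h : ∀ i j k : Fin n, tableTensor (e :: l) i j k =
      ((if i.val + 1 = e.1 ∧ j.val + 1 = e.2.1 ∧ k.val + 1 = e.2.2.1 then e.2.2.2 else 0) -
      (if i.val + 1 = e.2.1 ∧ j.val + 1 = e.1 ∧ k.val + 1 = e.2.2.1 then e.2.2.2 else 0)) +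
      tableTensor l i j k := fun i j k => by
        simp [tableTensor, and_left_comm (a := i.val + 1 = e.2.1)]
    simp only [h, mul_add, mul_sub, Finset.sum_add_distrib, Finset.sum_sub_distrib, ih,
      List.map_cons, List.sum_cons, hpt]

theorem IsHarmonic.coeff_orthogonal_table (hψ : IsHarmonic μ.basis w ψ)
    {l : List (ℕ × ℕ × ℕ × ℝ)} (hl : μ.1 = tableTensor l) (f : Fin n → ℝ) :
    (l.map fun e => e.2.2.2 * (coord (fun i => coord (fun j => coord (fun k =>
      w k / (w i * w j) * (f i + f j - f k) * μ.coeff ψ i j k) e.2.2.1) e.2.1) e.1 -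
      coord (fun i => coord (fun j => coord (fun k =>
      w k / (w i * w j) * (f i + f j - f k) * μ.coeff ψ i j k) e.2.2.1) e.1) e.2.1)).sum = 0 := by
  rw [← sum_mul_tableTensor, ← hl]
  exact hψ.coeff_orthogonal f

theorem LieLaw.eq_zero_of_coeff (h : ∀ i j k, i < j → μ.coeff ψ i j k = 0) : ψ = 0 := by
  apply cochainCoeff_injective μ.basis
  rw [map_zero]
  ext i j k
  rcases lt_trichotomy i j with hij | rfl | hij
  · exact h i j k hij
  · exact LieLaw.coeff_self ψ i k
  · exact (LieLaw.coeff_skew ψ i j k).trans (by rw [h j i k hij, neg_zero]; rfl)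

/-- The second adjoint cohomology vanishes if all harmonic cocycles do. -/
theorem LieLaw.subsingleton_adjointH2 (μ : LieLaw n) {w : Fin n → ℝ} (hw : ∀ i, 0 < w i)
    (h : ∀ ψ, IsHarmonic μ.basis w ψ → ∀ i j k, i < j → μ.coeff ψ i j k = 0) :
    Subsingleton (AdjointH2 μ.Alg) := by
  rw [subsingleton_adjointH2_iff]
  intro φ hφ
  obtain ⟨ψ, f, hψ, rfl⟩ := exists_isHarmonic_add_d₁₂ μ.basis hw hφ
  exact ⟨f, by rw [LieLaw.eq_zero_of_coeff (h ψ hψ), zero_add]⟩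

end Coordinates

/-! ### The algebra `L_{7,1}`. -/

theorem L71_bracket (x y : Fin 7 → ℝ) : L71.bracket x y =
    ![(x 1 * y 2 - x 2 * y 1),
      -(x 0 * y 2 - x 2 * y 0),
      (x 0 * y 1 - x 1 * y 0),
      (x 1 * y 5 - x 5 * y 1) - (x 2 * y 4 - x 4 * y 2) + (x 3 * y 6 - x 6 * y 3),
      -(x 0 * y 5 - x 5 * y 0) + (x 2 * y 3 - x 3 * y 2) + (x 4 * y 6 - x 6 * y 4),
      (x 0 * y 4 - x 4 * y 0) - (x 1 * y 3 - x 3 * y 1) + (x 5 * y 6 - x 6 * y 5),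
      0] := by
  ext k
  fin_cases k <;>
    simp [LieLaw.bracket, L71, tensorMap_tableTensor, so3Table, coord_seven] <;> ring

theorem L71_ad₀ (x : Fin 7 → ℝ) : L71.bracket (Pi.single 0 1) x =
    ![0, -x 2, x 1, 0, -x 5, x 4, 0] := by
  ext k
  fin_cases k <;> simp [L71_bracket]

theorem L71_ad₁ (x : Fin 7 → ℝ) : L71.bracket (Pi.single 1 1) x =
    ![x 2, 0, -x 0, x 5, 0, -x 3, 0] := by
  ext k
  fin_cases k <;> simp [L71_bracket]

theorem L71_ad₂ (x : Fin 7 → ℝ) : L71.bracket (Pi.single 2 1) x =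
    ![-x 1, x 0, 0, -x 4, x 3, 0, 0] := by
  ext k
  fin_cases k <;> simp [L71_bracket]

/-- The indices of the cochains of weight zero on `L71`, in groups for which the equations of
harmonic cocycles separate. -/
def L71Blocks : List (List (Fin 7 × Fin 7 × Fin 7)) :=
  [[(0, 1, 0), (0, 1, 6), (0, 2, 0), (0, 2, 6), (0, 3, 4), (0, 3, 5), (0, 4, 3), (0, 5, 3),
   (0, 6, 1), (0, 6, 2), (1, 2, 1), (1, 2, 2), (1, 3, 3), (1, 6, 0), (1, 6, 6), (2, 3, 3),
   (2, 6, 0), (2, 6, 6)],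
   [(0, 1, 1), (0, 2, 2), (0, 4, 4), (0, 6, 6), (1, 2, 6), (1, 3, 4), (1, 4, 3), (1, 6, 2),
   (2, 4, 4), (2, 5, 3), (2, 5, 4), (2, 6, 1), (3, 6, 4), (3, 6, 5), (4, 6, 3), (4, 6, 5),
   (5, 6, 3), (5, 6, 4)],
   [(0, 3, 3), (0, 5, 5), (1, 4, 4), (1, 4, 5), (1, 5, 4), (1, 5, 5), (2, 3, 5), (2, 4, 5),
   (2, 5, 5)],
   [(0, 1, 2), (0, 2, 1), (0, 4, 5), (0, 5, 4), (1, 2, 0), (1, 3, 5), (1, 5, 3), (2, 3, 4),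
   (2, 4, 3)],
   [(0, 6, 0), (1, 6, 1), (2, 6, 2), (3, 6, 3), (4, 6, 4), (5, 6, 5)]]

theorem mem_L71Blocks : ∀ i j k : Fin 7, i < j →
    (![0, 0, 0, -1, -1, -1, 0] : Fin 7 → ℤ) k = ![0, 0, 0, -1, -1, -1, 0] i + ![0, 0, 0, -1, -1, -1, 0] j →
    (i, j, k) ∈ L71Blocks.flatten := by decide

-- Let `s` be the Levi factor and `V` the span of `X₄, X₅, X₆`. Invariance under `s` and `X₇` leaves
-- four scalars, for `Λ²s → s`, `s ⊗ V → V`, `s ⊗ X₇ → s` and `V ⊗ X₇ → V`. The cocycle equations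
-- equate the first two and kill the third, because a scalar derivation of `s` is zero. What remains
-- is rescaling `s` and rescaling `X₇`, both coboundary directions.
set_option maxHeartbeats 2000000 in
theorem L71_coeff_eq_zero {ψ} (hψ : IsHarmonic L71.basis (fun _ => 1) ψ) (i j k : Fin 7)
    (hij : i < j) : L71.coeff ψ i j k = 0 := by
  have hw : ∀ i : Fin 7, 0 < (fun _ => 1 : Fin 7 → ℝ) i := fun _ => one_pos
  have h₆ := hψ.coeff_intWeight hw 6 ![0, 0, 0, -1, -1, -1, 0] (fun x k => by
    fin_cases k <;> simp [L71_bracket]) i j k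
  have h₀ := hψ.coeff_invariant hw (-1) L71_ad₀ L71_ad₀
    (B := fun x => ![0, x 2, -x 1, 0, x 5, -x 4, 0])
    (fun x i => by fin_cases i <;> simp [Fin.sum_univ_seven])
    (fun x i => by fin_cases i <;> simp)
  have h₁ := hψ.coeff_invariant hw (-1) L71_ad₁ L71_ad₁
    (B := fun x => ![-x 2, 0, x 0, -x 5, 0, x 3, 0])
    (fun x i => by fin_cases i <;> simp [Fin.sum_univ_seven])
    (fun x i => by fin_cases i <;> simp)
  have h₂ := hψ.coeff_invariant hw (-1) L71_ad₂ L71_ad₂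
    (B := fun x => ![x 1, -x 0, 0, x 4, -x 3, 0, 0])
    (fun x i => by fin_cases i <;> simp [Fin.sum_univ_seven])
    (fun x i => by fin_cases i <;> simp)
  have hs : ∀ i j k, j < i → L71.coeff ψ i j k = -L71.coeff ψ j i k := fun i j k _ =>
    LieLaw.coeff_skew ψ i j k
  have hd : ∀ i k, L71.coeff ψ i i k = 0 := LieLaw.coeff_self ψ
  have hc := hψ.coeff_cocycle
  -- The two diagonal endomorphisms rescale the Levi factor and `X₇`.
  have o₁ := hψ.coeff_orthogonal_table rfl ![1, 1, 1, 0, 0, 0, 0]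
  have o₂ := hψ.coeff_orthogonal_table rfl ![0, 0, 0, 0, 0, 0, 1]
  generalize L71.coeff ψ = c at *
  simp [so3Table, coord_seven, hs] at o₁ o₂
  simp only [L71_bracket] at hc
  have hzero : ∀ l ∈ L71Blocks, ∀ t ∈ l, c t.1 t.2.1 t.2.2 = 0 := by
    simp only [L71Blocks, List.forall_mem_cons, List.not_mem_nil, false_imp_iff, implies_true,
      and_true]
    refine ⟨?_, ?_, ?_, ?_, ?_⟩
    · have e₁ := h₀ 0 1 0
      have e₂ := h₀ 0 1 6
      have e₃ := h₀ 0 2 0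
      have e₄ := h₀ 0 2 6
      have e₅ := h₀ 0 3 4
      have e₆ := h₀ 0 3 5
      have e₇ := h₀ 0 4 3
      have e₈ := h₀ 0 5 3
      have e₉ := h₀ 0 6 1
      have e₁₀ := h₀ 0 6 2
      have e₁₁ := h₀ 1 2 1
      have e₁₂ := h₀ 1 2 2
      have e₁₃ := h₀ 1 3 3
      have e₁₄ := h₀ 1 6 0
      have e₁₅ := h₀ 1 6 6
      have e₁₆ := h₀ 2 3 3
      have e₁₇ := h₀ 2 6 0
      have e₁₈ := h₀ 2 6 6
      simp [hs, hd] at e₁ e₂ e₃ e₄ e₅ e₆ e₇ e₈ e₉ e₁₀ e₁₁ e₁₂ e₁₃ e₁₄ e₁₅ e₁₆ e₁₇ e₁₈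
      clear hs hd h₀ h₁ h₂ hc h₆
      constructorm* _ ∧ _ <;> first | assumption | exact Eq.symm ‹_›
    · have e₁ := h₀ 3 6 4
      have e₂ := h₀ 3 6 5
      have e₃ := h₀ 4 6 3
      have e₄ := h₀ 5 6 3
      have e₅ := h₁ 0 1 6
      have e₆ := h₁ 0 2 0
      have e₇ := h₁ 0 4 4
      have e₈ := h₁ 0 6 1
      have e₉ := h₁ 1 2 1
      have e₁₀ := h₁ 1 4 5
      have e₁₁ := h₁ 1 5 4
      have e₁₂ := h₁ 1 6 0
      have e₁₃ := h₁ 2 4 4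
      have e₁₄ := h₁ 2 6 6
      have e₁₅ := h₁ 3 6 4
      have e₁₆ := h₁ 4 6 3
      have e₁₇ := h₂ 2 5 3
      have e₁₈ := h₂ 2 5 4
      simp [hs, hd] at e₁ e₂ e₃ e₄ e₅ e₆ e₇ e₈ e₉ e₁₀ e₁₁ e₁₂ e₁₃ e₁₄ e₁₅ e₁₆ e₁₇ e₁₈
      clear hs hd h₀ h₁ h₂ hc h₆
      constructorm* _ ∧ _ <;> first | assumption | exact Eq.symm ‹_›
    · have e₁ := h₁ 1 3 4
      have e₂ := h₁ 1 4 3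
      have e₃ := h₀ 1 5 5
      have e₄ := h₂ 0 5 5
      have e₅ := h₂ 2 3 5
      have e₆ := h₀ 1 4 5
      have e₇ := h₂ 1 5 5
      have e₈ := h₂ 2 4 5
      have e₉ := h₁ 0 3 5
      simp [hs, hd] at e₁ e₂ e₃ e₄ e₅ e₆ e₇ e₈ e₉
      clear hs hd h₀ h₁ h₂ hc h₆
      constructorm* _ ∧ _ <;> grind only
    · have e₁ := h₀ 0 1 1
      have e₂ := h₀ 0 4 4
      have e₃ := h₀ 1 3 4
      have e₄ := h₀ 1 4 3
      have e₅ := h₁ 0 1 0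
      have e₆ := h₁ 0 3 4
      have e₇ := h₁ 0 4 3
      have e₈ := hc 0 1 3 4
      simp [Fin.sum_univ_seven, hs, hd] at e₁ e₂ e₃ e₄ e₅ e₆ e₇ e₈
      clear hs hd h₀ h₁ h₂ hc h₆
      constructorm* _ ∧ _ <;> grind only
    · have e₁ := h₀ 1 6 2
      have e₂ := h₁ 0 6 2
      have e₃ := hc 0 1 6 2
      have e₄ := h₀ 4 6 5
      have e₅ := h₁ 3 6 5
      simp [Fin.sum_univ_seven, hs, hd] at e₁ e₂ e₃ e₄ e₅
      clear hs hd h₀ h₁ h₂ hc h₆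
      constructorm* _ ∧ _ <;> grind only
  by_contra hne
  have hmem := mem_L71Blocks i j k hij (not_not.1 (mt h₆ hne))
  obtain ⟨l, hl, ht⟩ := List.mem_flatten.1 hmem
  exact hne (hzero l hl _ ht)

theorem L71_subsingleton_adjointH2 : Subsingleton (AdjointH2 L71.Alg) :=
  LieLaw.subsingleton_adjointH2 L71 (w := fun _ => 1) (fun _ => one_pos)
    fun _ hψ => L71_coeff_eq_zero hψ

/-! ### The algebra `L_{7,2}`. -/

theorem L72_bracket (x y : Fin 7 → ℝ) : L72.bracket x y =
    ![(x 1 * y 2 - x 2 * y 1),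
      -(x 0 * y 2 - x 2 * y 0),
      (x 0 * y 1 - x 1 * y 0),
      (1/2) * (x 6 * y 0 - x 0 * y 6) + (1/2) * (x 4 * y 1 - x 1 * y 4) + (1/2) * (x 5 * y 2 - x 2 * y 5),
      (1/2) * (x 5 * y 0 - x 0 * y 5) + (1/2) * (x 1 * y 3 - x 3 * y 1) + (1/2) * (x 2 * y 6 - x 6 * y 2),
      (1/2) * (x 0 * y 4 - x 4 * y 0) + (1/2) * (x 6 * y 1 - x 1 * y 6) + (1/2) * (x 2 * y 3 - x 3 * y 2),
      (1/2) * (x 0 * y 3 - x 3 * y 0) + (1/2) * (x 1 * y 5 - x 5 * y 1) + (1/2) * (x 4 * y 2 - x 2 * y 4)] := by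
  ext k
  fin_cases k <;>
    simp [LieLaw.bracket, L72, tensorMap_tableTensor, so3Table, coord_seven] <;> ring

theorem L72_ad₀ (x : Fin 7 → ℝ) : L72.bracket (Pi.single 0 1) x =
    ![0, -x 2, x 1, -(x 6 / 2), -(x 5 / 2), x 4 / 2, x 3 / 2] := by
  ext k
  fin_cases k <;> simp [L72_bracket] <;> ring

theorem L72_ad₁ (x : Fin 7 → ℝ) : L72.bracket (Pi.single 1 1) x =
    ![x 2, 0, -x 0, -(x 4 / 2), x 3 / 2, -(x 6 / 2), x 5 / 2] := by
  ext k
  fin_cases k <;> simp [L72_bracket] <;> ring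

theorem L72_ad₂ (x : Fin 7 → ℝ) : L72.bracket (Pi.single 2 1) x =
    ![-x 1, x 0, 0, -(x 5 / 2), x 6 / 2, x 3 / 2, -(x 4 / 2)] := by
  ext k
  fin_cases k <;> simp [L72_bracket] <;> ring

/-- The indices of the cochains on `L72`, in groups for which the equations of
harmonic cocycles separate. -/
def L72Blocks : List (List (Fin 7 × Fin 7 × Fin 7)) :=
  [[(0, 1, 0), (0, 2, 0), (0, 3, 0), (0, 4, 0), (0, 5, 0), (0, 6, 0), (1, 2, 1), (1, 2, 2),
   (1, 2, 3), (1, 2, 4), (1, 2, 5), (1, 2, 6), (3, 6, 1), (3, 6, 2), (3, 6, 3), (3, 6, 4),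
   (3, 6, 5), (3, 6, 6), (4, 5, 1), (4, 5, 2), (4, 5, 5), (4, 5, 6)],
   [(0, 1, 1), (0, 2, 2), (0, 2, 3), (0, 2, 4), (0, 2, 5), (0, 2, 6), (1, 3, 1), (1, 4, 1),
   (1, 5, 1), (1, 6, 1), (3, 4, 0), (3, 4, 2), (3, 4, 3), (3, 4, 4), (3, 4, 5), (3, 4, 6),
   (4, 5, 3), (4, 5, 4), (5, 6, 0), (5, 6, 2), (5, 6, 3), (5, 6, 4)],
   [(0, 1, 3), (0, 1, 4), (0, 1, 5), (0, 1, 6), (2, 3, 2), (2, 4, 2), (2, 5, 2), (2, 6, 2),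
   (3, 5, 0), (3, 5, 1), (3, 5, 3), (3, 5, 4), (3, 5, 5), (3, 5, 6), (4, 6, 0), (4, 6, 1),
   (4, 6, 3), (4, 6, 4), (4, 6, 5), (4, 6, 6), (5, 6, 5), (5, 6, 6)],
   [(0, 1, 2), (0, 2, 1), (0, 3, 6), (0, 4, 5), (0, 5, 4), (0, 6, 3), (1, 2, 0), (1, 3, 4),
   (1, 4, 3), (1, 5, 6), (1, 6, 5), (2, 3, 5), (2, 4, 6), (2, 5, 3), (2, 6, 4)],
   [(0, 3, 5), (0, 4, 6), (0, 5, 3), (0, 6, 4), (1, 3, 3), (1, 4, 4), (1, 5, 5), (1, 6, 6),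
   (2, 3, 6), (2, 4, 5), (2, 5, 4), (2, 6, 3)],
   [(0, 3, 4), (0, 4, 3), (0, 5, 6), (0, 6, 5), (1, 3, 6), (1, 4, 5), (1, 5, 4), (1, 6, 3),
   (2, 3, 3), (2, 4, 4), (2, 5, 5), (2, 6, 6)],
   [(0, 3, 3), (0, 4, 4), (0, 5, 5), (0, 6, 6), (1, 3, 5), (1, 4, 6), (1, 5, 3), (1, 6, 4),
   (2, 3, 4), (2, 4, 3), (2, 5, 6), (2, 6, 5)],
   [(0, 3, 1), (0, 3, 2), (0, 4, 2), (0, 5, 1), (0, 6, 1), (0, 6, 2), (2, 4, 1), (2, 5, 1),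
   (2, 6, 1)],
   [(0, 4, 1), (0, 5, 2), (1, 5, 0), (1, 5, 2), (1, 6, 0), (1, 6, 2), (2, 3, 0), (2, 3, 1),
   (2, 4, 0)],
   [(3, 4, 1), (3, 5, 2), (3, 6, 0), (4, 5, 0), (4, 6, 2), (5, 6, 1)],
   [(1, 3, 0), (1, 3, 2), (1, 4, 0), (1, 4, 2), (2, 5, 0), (2, 6, 0)]]

theorem mem_L72Blocks : ∀ i j k : Fin 7, i < j →
    (i, j, k) ∈ L72Blocks.flatten := by decide

-- The radical `V` is the quaternions as a module over the Levi factor `s`. Components with an odd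
-- number of entries in `V` vanish by invariance, and six scalars survive: one for `Λ²s → s`, four
-- for `s ⊗ V → V` (the commutant of the action is the quaternions) and one for `Λ²V → s`. The
-- cocycle equations kill the last one and the imaginary part of the commutant scalar, and equate
-- its real part with the first. Orthogonality to the rescaling of `s` finishes.
set_option maxHeartbeats 2000000 in
theorem L72_coeff_eq_zero {ψ} (hψ : IsHarmonic L72.basis (fun _ => 1) ψ) (i j k : Fin 7)
    (hij : i < j) : L72.coeff ψ i j k = 0 := by
  have hw : ∀ i : Fin 7, 0 < (fun _ => 1 : Fin 7 → ℝ) i := fun _ => one_pos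
  have h₀ := hψ.coeff_invariant hw (-1) L72_ad₀ L72_ad₀
    (B := fun x => ![0, x 2, -x 1, x 6 / 2, x 5 / 2, -(x 4 / 2), -(x 3 / 2)])
    (fun x i => by fin_cases i <;> simp [Fin.sum_univ_seven] <;> ring)
    (fun x i => by fin_cases i <;> simp)
  have h₁ := hψ.coeff_invariant hw (-1) L72_ad₁ L72_ad₁
    (B := fun x => ![-x 2, 0, x 0, x 4 / 2, -(x 3 / 2), x 6 / 2, -(x 5 / 2)])
    (fun x i => by fin_cases i <;> simp [Fin.sum_univ_seven] <;> ring)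
    (fun x i => by fin_cases i <;> simp)
  have h₂ := hψ.coeff_invariant hw (-1) L72_ad₂ L72_ad₂
    (B := fun x => ![x 1, -x 0, 0, x 5 / 2, -(x 6 / 2), -(x 3 / 2), x 4 / 2])
    (fun x i => by fin_cases i <;> simp [Fin.sum_univ_seven] <;> ring)
    (fun x i => by fin_cases i <;> simp)
  have hs : ∀ i j k, j < i → L72.coeff ψ i j k = -L72.coeff ψ j i k := fun i j k _ =>
    LieLaw.coeff_skew ψ i j k
  have hd : ∀ i k, L72.coeff ψ i i k = 0 := LieLaw.coeff_self ψ
  have hc := hψ.coeff_cocycle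
  have o₁ := hψ.coeff_orthogonal_table rfl ![1, 1, 1, 0, 0, 0, 0]
  generalize L72.coeff ψ = c at *
  simp [so3Table, coord_seven, hs] at o₁
  simp only [L72_bracket] at hc
  have hzero : ∀ l ∈ L72Blocks, ∀ t ∈ l, c t.1 t.2.1 t.2.2 = 0 := by
    simp only [L72Blocks, List.forall_mem_cons, List.not_mem_nil, false_imp_iff, implies_true,
      and_true]
    refine ⟨?_, ?_, ?_, ?_, ?_, ?_, ?_, ?_, ?_, ?_, ?_⟩
    · have e₁ := h₀ 0 1 0
      have e₂ := h₀ 0 2 0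
      have e₃ := h₀ 0 3 0
      have e₄ := h₀ 0 4 0
      have e₅ := h₀ 0 5 0
      have e₆ := h₀ 0 6 0
      have e₇ := h₀ 1 2 1
      have e₈ := h₀ 1 2 2
      have e₉ := h₀ 1 2 3
      have e₁₀ := h₀ 1 2 4
      have e₁₁ := h₀ 1 2 5
      have e₁₂ := h₀ 1 2 6
      have e₁₃ := h₀ 3 6 1
      have e₁₄ := h₀ 3 6 2
      have e₁₅ := h₀ 3 6 3
      have e₁₆ := h₀ 3 6 4
      have e₁₇ := h₀ 3 6 5
      have e₁₈ := h₀ 3 6 6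
      have e₁₉ := h₀ 4 5 1
      have e₂₀ := h₀ 4 5 2
      have e₂₁ := h₀ 4 5 3
      have e₂₂ := h₀ 4 5 4
      simp [hs, hd] at e₁ e₂ e₃ e₄ e₅ e₆ e₇ e₈ e₉ e₁₀ e₁₁
      simp [hs, hd] at e₁₂ e₁₃ e₁₄ e₁₅ e₁₆ e₁₇ e₁₈ e₁₉ e₂₀ e₂₁ e₂₂
      clear hs hd h₀ h₁ h₂ hc
      constructorm* _ ∧ _ <;> first | assumption | exact Eq.symm ‹_› | grind only
    · have e₁ := h₀ 4 5 5
      have e₂ := h₀ 4 5 6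
      have e₃ := h₁ 0 2 0
      have e₄ := h₁ 0 2 3
      have e₅ := h₁ 0 2 4
      have e₆ := h₁ 0 2 5
      have e₇ := h₁ 0 2 6
      have e₈ := h₁ 1 2 1
      have e₉ := h₁ 1 3 1
      have e₁₀ := h₁ 1 4 1
      have e₁₁ := h₁ 1 5 1
      have e₁₂ := h₁ 1 6 1
      have e₁₃ := h₁ 3 4 0
      have e₁₄ := h₁ 3 4 2
      have e₁₅ := h₁ 3 4 3
      have e₁₆ := h₁ 3 4 4
      have e₁₇ := h₁ 3 4 5
      have e₁₈ := h₁ 3 4 6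
      have e₁₉ := h₁ 5 6 0
      have e₂₀ := h₁ 5 6 2
      have e₂₁ := h₁ 5 6 3
      have e₂₂ := h₁ 5 6 4
      simp [hs, hd] at e₁ e₂ e₃ e₄ e₅ e₆ e₇ e₈ e₉ e₁₀ e₁₁
      simp [hs, hd] at e₁₂ e₁₃ e₁₄ e₁₅ e₁₆ e₁₇ e₁₈ e₁₉ e₂₀ e₂₁ e₂₂
      clear hs hd h₀ h₁ h₂ hc
      constructorm* _ ∧ _ <;> first | assumption | exact Eq.symm ‹_› | grind only
    · have e₁ := h₁ 5 6 5
      have e₂ := h₁ 5 6 6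
      have e₃ := h₂ 0 1 3
      have e₄ := h₂ 0 1 4
      have e₅ := h₂ 0 1 5
      have e₆ := h₂ 0 1 6
      have e₇ := h₂ 2 3 2
      have e₈ := h₂ 2 4 2
      have e₉ := h₂ 2 5 2
      have e₁₀ := h₂ 2 6 2
      have e₁₁ := h₂ 3 5 0
      have e₁₂ := h₂ 3 5 1
      have e₁₃ := h₂ 3 5 3
      have e₁₄ := h₂ 3 5 4
      have e₁₅ := h₂ 3 5 5
      have e₁₆ := h₂ 3 5 6
      have e₁₇ := h₂ 4 6 0
      have e₁₈ := h₂ 4 6 1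
      have e₁₉ := h₂ 4 6 3
      have e₂₀ := h₂ 4 6 4
      have e₂₁ := h₂ 4 6 5
      have e₂₂ := h₂ 4 6 6
      simp [hs, hd] at e₁ e₂ e₃ e₄ e₅ e₆ e₇ e₈ e₉ e₁₀ e₁₁
      simp [hs, hd] at e₁₂ e₁₃ e₁₄ e₁₅ e₁₆ e₁₇ e₁₈ e₁₉ e₂₀ e₂₁ e₂₂
      clear hs hd h₀ h₁ h₂ hc
      constructorm* _ ∧ _ <;> first | assumption | exact Eq.symm ‹_› | grind only
    · have e₁ := h₀ 0 1 1
      have e₂ := h₀ 0 3 3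
      have e₃ := h₀ 0 4 4
      have e₄ := h₁ 0 1 0
      have e₅ := h₁ 1 3 3
      have e₆ := h₁ 1 5 5
      have e₇ := h₂ 2 3 3
      have e₈ := h₂ 2 4 4
      have e₉ := h₀ 1 3 5
      have e₁₀ := h₀ 1 4 6
      have e₁₁ := h₀ 2 3 4
      have e₁₂ := h₁ 0 3 5
      have e₁₃ := h₁ 2 3 6
      have e₁₄ := hc 0 1 3 5
      simp [Fin.sum_univ_seven, hs, hd] at e₁ e₂ e₃ e₄ e₅ e₆ e₇ e₈ e₉ e₁₀ e₁₁ e₁₂ e₁₃ e₁₄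
      clear hs hd h₀ h₁ h₂ hc
      constructorm* _ ∧ _ <;> grind only
    · have e₁ := h₀ 0 3 4
      have e₂ := h₀ 0 4 3
      have e₃ := h₁ 1 3 4
      have e₄ := h₁ 1 5 6
      have e₅ := h₂ 2 3 4
      have e₆ := h₂ 2 4 3
      have e₇ := h₀ 1 3 6
      have e₈ := h₀ 1 4 5
      have e₉ := h₀ 2 3 3
      have e₁₀ := h₁ 0 3 6
      have e₁₁ := h₁ 2 3 5
      have e₁₂ := hc 0 2 3 3
      simp [Fin.sum_univ_seven, hs, hd] at e₁ e₂ e₃ e₄ e₅ e₆ e₇ e₈ e₉ e₁₀ e₁₁ e₁₂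
      clear hs hd h₀ h₁ h₂ hc
      constructorm* _ ∧ _ <;> grind only
    · have e₁ := h₀ 0 3 5
      have e₂ := h₀ 0 4 6
      have e₃ := h₁ 1 3 5
      have e₄ := h₁ 1 5 3
      have e₅ := h₂ 2 3 5
      have e₆ := h₂ 2 4 6
      have e₇ := h₀ 1 3 3
      have e₈ := h₀ 1 4 4
      have e₉ := h₀ 2 3 6
      have e₁₀ := h₁ 0 3 3
      have e₁₁ := h₁ 2 3 4
      have e₁₂ := hc 0 1 3 3
      simp [Fin.sum_univ_seven, hs, hd] at e₁ e₂ e₃ e₄ e₅ e₆ e₇ e₈ e₉ e₁₀ e₁₁ e₁₂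
      clear hs hd h₀ h₁ h₂ hc
      constructorm* _ ∧ _ <;> grind only
    · have e₁ := h₀ 0 3 6
      have e₂ := h₀ 0 4 5
      have e₃ := h₁ 1 3 6
      have e₄ := h₁ 1 5 4
      have e₅ := h₂ 2 3 6
      have e₆ := h₂ 2 4 5
      have e₇ := h₀ 1 3 4
      have e₈ := h₀ 1 4 3
      have e₉ := h₀ 2 3 5
      have e₁₀ := h₁ 0 3 4
      have e₁₁ := h₁ 2 3 3
      have e₁₂ := hc 1 2 3 3
      simp [Fin.sum_univ_seven, hs, hd] at e₁ e₂ e₃ e₄ e₅ e₆ e₇ e₈ e₉ e₁₀ e₁₁ e₁₂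
      clear hs hd h₀ h₁ h₂ hc
      constructorm* _ ∧ _ <;> grind only
    · have e₁ := h₀ 0 3 1
      have e₂ := h₀ 0 6 2
      have e₃ := h₁ 0 5 1
      have e₄ := h₀ 0 3 2
      have e₅ := h₀ 0 6 1
      have e₆ := h₁ 0 4 1
      have e₇ := h₀ 0 4 1
      have e₈ := h₀ 0 5 2
      have e₉ := h₁ 0 6 1
      simp [hs, hd] at e₁ e₂ e₃ e₄ e₅ e₆ e₇ e₈ e₉
      clear hs hd h₀ h₁ h₂ hc
      constructorm* _ ∧ _ <;> grind only
    · have e₁ := h₀ 0 4 2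
      have e₂ := h₀ 0 5 1
      have e₃ := h₁ 0 3 1
      have e₄ := h₀ 1 3 0
      have e₅ := h₀ 2 6 0
      have e₆ := h₁ 1 5 0
      have e₇ := h₀ 1 4 0
      have e₈ := h₀ 2 5 0
      have e₉ := h₁ 1 5 2
      simp [hs, hd] at e₁ e₂ e₃ e₄ e₅ e₆ e₇ e₈ e₉
      clear hs hd h₀ h₁ h₂ hc
      constructorm* _ ∧ _ <;> grind only
    · have e₁ := h₀ 3 4 2
      have e₂ := h₀ 3 5 1
      have e₃ := h₀ 4 6 1
      have e₄ := h₁ 3 5 0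
      have e₅ := h₁ 3 6 2
      have e₆ := hc 3 4 5 6
      simp [Fin.sum_univ_seven, hs, hd] at e₁ e₂ e₃ e₄ e₅ e₆
      clear hs hd h₀ h₁ h₂ hc
      constructorm* _ ∧ _ <;> grind only
    · have e₁ := h₀ 1 5 0
      have e₂ := h₀ 2 4 0
      have e₃ := h₁ 1 3 0
      have e₄ := h₀ 1 6 0
      have e₅ := h₀ 2 3 0
      have e₆ := h₁ 1 3 2
      simp [hs, hd] at e₁ e₂ e₃ e₄ e₅ e₆
      clear hs hd h₀ h₁ h₂ hc
      constructorm* _ ∧ _ <;> grind only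
  have hmem := mem_L72Blocks i j k hij
  obtain ⟨l, hl, ht⟩ := List.mem_flatten.1 hmem
  exact hzero l hl _ ht

theorem L72_subsingleton_adjointH2 : Subsingleton (AdjointH2 L72.Alg) :=
  LieLaw.subsingleton_adjointH2 L72 (w := fun _ => 1) (fun _ => one_pos)
    fun _ hψ => L72_coeff_eq_zero hψ

/-! ### The family `L_{7,3}^p`. -/

theorem L73_bracket (p : ℝ) (x y : Fin 7 → ℝ) : (L73 p).bracket x y =
    ![(x 1 * y 2 - x 2 * y 1),
      2 * (x 0 * y 1 - x 1 * y 0),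
      -2 * (x 0 * y 2 - x 2 * y 0),
      (x 0 * y 3 - x 3 * y 0) + (x 1 * y 4 - x 4 * y 1) + (x 3 * y 6 - x 6 * y 3),
      -(x 0 * y 4 - x 4 * y 0) + (x 2 * y 3 - x 3 * y 2) + (x 4 * y 6 - x 6 * y 4),
      p * (x 5 * y 6 - x 6 * y 5),
      0] := by
  ext k
  fin_cases k <;>
    simp [LieLaw.bracket, L73, tensorMap_tableTensor, sl2Table, coord_seven] <;> ring

theorem L73_ad₁ (p : ℝ) (x : Fin 7 → ℝ) : (L73 p).bracket (Pi.single 1 1) x =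
    ![x 2, -2 * x 0, 0, x 4, 0, 0, 0] := by
  ext k
  fin_cases k <;> simp [L73_bracket]

theorem L73_ad₂ (p : ℝ) (x : Fin 7 → ℝ) : (L73 p).bracket (Pi.single 2 1) x =
    ![-x 1, 0, 2 * x 0, 0, x 3, 0, 0] := by
  ext k
  fin_cases k <;> simp [L73_bracket]

/-- The indices of the cochains on `L73 p` of weight zero for `X₁`. -/
def L73Support : List (Fin 7 × Fin 7 × Fin 7) :=
  [(0, 1, 1), (0, 2, 2), (0, 3, 3), (0, 4, 4), (0, 5, 0), (0, 5, 5), (0, 5, 6), (0, 6, 0),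
  (0, 6, 5), (0, 6, 6), (1, 2, 0), (1, 2, 5), (1, 2, 6), (1, 4, 3), (1, 5, 1), (1, 6, 1),
  (2, 3, 4), (2, 5, 2), (2, 6, 2), (3, 4, 0), (3, 4, 5), (3, 4, 6), (3, 5, 3), (3, 6, 3),
  (4, 5, 4), (4, 6, 4), (5, 6, 0), (5, 6, 5), (5, 6, 6)]

theorem mem_L73Support : ∀ i j k : Fin 7, i < j →
    (![0, 2, -2, 1, -1, 0, 0] : Fin 7 → ℤ) k =
      ![0, 2, -2, 1, -1, 0, 0] i + ![0, 2, -2, 1, -1, 0, 0] j →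
    (i, j, k) ∈ L73Support := by decide

theorem L73_weight_pos (i : Fin 7) : 0 < (![2, 1, 1, 1, 1, 1, 1] : Fin 7 → ℝ) i := by
  revert i; simp [Fin.forall_fin_succ]

theorem L73_coeff_weight {p : ℝ} {ψ}
    (hψ : IsHarmonic (L73 p).basis ![2, 1, 1, 1, 1, 1, 1] ψ) (i j k : Fin 7)
    (hne : (![0, 0, 0, -1, -1, -p, 0] : Fin 7 → ℝ) k ≠
      ![0, 0, 0, -1, -1, -p, 0] i + ![0, 0, 0, -1, -1, -p, 0] j) :
    (L73 p).coeff ψ i j k = 0 :=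
  hψ.coeff_weight L73_weight_pos 6 (wt := ![0, 0, 0, -1, -1, -p, 0])
    (fun x k => by fin_cases k <;> simp [L73_bracket]) hne

set_option maxHeartbeats 1000000 in
/-- A harmonic cocycle on `L73 p` is determined by two linear forms, which vanish on
coboundaries. -/
theorem L73_coeff_eq_zero {p : ℝ} (hp : p ≠ 0) {ψ}
    (hψ : IsHarmonic (L73 p).basis ![2, 1, 1, 1, 1, 1, 1] ψ)
    (h345 : (L73 p).coeff ψ 3 4 5 = 0)
    (h565 : (L73 p).coeff ψ 5 6 5 =
      p / 2 * ((L73 p).coeff ψ 3 6 3 + (L73 p).coeff ψ 4 6 4)) (i j k : Fin 7)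
    (hij : i < j) : (L73 p).coeff ψ i j k = 0 := by
  have hw := L73_weight_pos
  have h₀ := hψ.coeff_intWeight hw 0 ![0, 2, -2, 1, -1, 0, 0] (fun x k => by
    fin_cases k <;> simp [L73_bracket]) i j k
  have h₆ := L73_coeff_weight hψ
  have h₁ := hψ.coeff_invariant hw 1 (L73_ad₁ p) (L73_ad₂ p)
    (B := fun x => ![-2 * x 1, 0, x 0, 0, x 3, 0, 0])
    (fun x i => by fin_cases i <;> simp [Fin.sum_univ_seven])
    (fun x i => by fin_cases i <;> simp)
  have h₂ := hψ.coeff_invariant hw 1 (L73_ad₂ p) (L73_ad₁ p)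
    (B := fun x => ![2 * x 2, -x 0, 0, x 4, 0, 0, 0])
    (fun x i => by fin_cases i <;> simp [Fin.sum_univ_seven])
    (fun x i => by fin_cases i <;> simp)
  have hs : ∀ i j k, j < i → (L73 p).coeff ψ i j k = -(L73 p).coeff ψ j i k := fun i j k _ =>
    LieLaw.coeff_skew ψ i j k
  have hd : ∀ i k, (L73 p).coeff ψ i i k = 0 := LieLaw.coeff_self ψ
  have hc := hψ.coeff_cocycle
  have o₁ := hψ.coeff_orthogonal_table rfl ![1, 1, 1, 0, 0, 0, 0]
  have o₂ := hψ.coeff_orthogonal_table rfl ![0, 0, 0, 0, 0, 0, 1]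
  generalize (L73 p).coeff ψ = c at *
  have hzero : ∀ t ∈ L73Support, c t.1 t.2.1 t.2.2 = 0 := by
    -- The weights of `X₇` depend on `p`, so these entries are excluded one at a time; `p ≠ 0`
    -- suffices for all of them.
    have z₁ : c 0 5 0 = 0 := h₆ 0 5 0 (by simpa using hp)
    have z₂ : c 0 5 6 = 0 := h₆ 0 5 6 (by simpa using hp)
    have z₃ : c 0 6 5 = 0 := h₆ 0 6 5 (by simpa using hp)
    have z₄ : c 1 2 5 = 0 := h₆ 1 2 5 (by simpa using hp)
    have z₅ : c 1 5 1 = 0 := h₆ 1 5 1 (by simpa using hp)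
    have z₆ : c 2 5 2 = 0 := h₆ 2 5 2 (by simpa using hp)
    have z₇ : c 3 4 0 = 0 := h₆ 3 4 0 (by simp; norm_num)
    have z₈ : c 3 4 6 = 0 := h₆ 3 4 6 (by simp; norm_num)
    have z₉ : c 3 5 3 = 0 := h₆ 3 5 3 (by simpa using hp)
    have z₁₀ : c 4 5 4 = 0 := h₆ 4 5 4 (by simpa using hp)
    have z₁₁ : c 5 6 0 = 0 := h₆ 5 6 0 (by simpa using hp)
    have z₁₂ : c 5 6 6 = 0 := h₆ 5 6 6 (by simpa using hp)
    have e₁ := h₁ 0 2 6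
    have e₂ := h₁ 2 5 5
    have e₃ := h₁ 2 6 6
    have e₄ := h₁ 0 2 0
    have e₅ := h₁ 0 6 1
    have e₆ := h₁ 1 2 1
    have e₇ := h₁ 2 3 3
    have e₈ := h₁ 2 4 4
    have e₉ := h₁ 2 6 0
    have e₁₀ := h₁ 4 6 3
    have e₁₁ := h₂ 1 3 3
    have e₁₂ := hc 0 1 6 1
    have e₁₃ := hc 0 1 4 3
    simp [L73_bracket, Fin.sum_univ_seven, hs, hd]
      at e₁ e₂ e₃ e₄ e₅ e₆ e₇ e₈ e₉ e₁₀ e₁₁ e₁₂ e₁₃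
    simp [sl2Table, coord_seven, hs] at o₁ o₂
    clear hs hd h₁ h₂ hc h₀ h₆
    have y₁ : c 4 6 4 = c 3 6 3 := by grind only
    -- Rescaling `X₇` moves the entries `(3,6,3)`, `(4,6,4)`, `(5,6,5)` along `(1, 1, p)`. By `y₁`
    -- and `h565` the cocycle lies on this line, and by `o₂` it is orthogonal to it; `2 + p²` is the
    -- squared length of `(1, 1, p)`.
    have y₂ : c 3 6 3 = 0 := by
      rw [y₁] at h565 o₂
      have : (2 + p ^ 2) * c 3 6 3 = 0 := by linear_combination o₂ / 2 - p * h565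
      exact (mul_eq_zero.1 this).resolve_left (by positivity)
    rw [y₁, y₂] at h565
    norm_num at h565
    clear o₂
    simp only [L73Support, List.forall_mem_cons, List.not_mem_nil, false_imp_iff, implies_true,
      and_true]
    constructorm* _ ∧ _ <;> first | assumption | grind only
  by_contra hne
  exact hne (hzero (i, j, k) (mem_L73Support i j k hij (not_not.1 (mt h₀ hne))))

/-- The coordinates of the coboundary of an endomorphism of `L73 p`. -/
theorem L73_coeff_d₁₂ {p : ℝ} (f : oneCochain ℝ (L73 p).Alg (L73 p).Alg) :
    (L73 p).coeff (d₁₂ ℝ _ _ f) 3 4 5 = 0 ∧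
    (L73 p).coeff (d₁₂ ℝ _ _ f) 5 6 5 = p / 2 *
      ((L73 p).coeff (d₁₂ ℝ _ _ f) 3 6 3 + (L73 p).coeff (d₁₂ ℝ _ _ f) 4 6 4) := by
  simp only [LieLaw.coeff, cochainCoeff_d₁₂, LieLaw.structureConst_basis,
    ← LieLaw.bracket_single_single, L73_bracket, Fin.sum_univ_seven]
  generalize (L73 p).basis.repr = r
  constructor
  · simp
  -- The `X₁`-component of `f X₇` enters the entries `(3,6,3)` and `(4,6,4)` with opposite signs, so
  -- only their sum can appear. What is left on both sides is `p` times the `X₇`-component of `f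
  -- X₇`.
  · simp
    ring

/-- A linear form on 2-cochains of `L73 p` that vanishes on coboundaries. -/
def L73Form (p : ℝ) : twoCochain ℝ (L73 p).Alg (L73 p).Alg →ₗ[ℝ] ℝ where
  toFun φ := (L73 p).coeff φ 5 6 5 - p / 2 * ((L73 p).coeff φ 3 6 3 + (L73 p).coeff φ 4 6 4)
  map_add' φ ψ := by simp only [LieLaw.coeff, map_add, Pi.add_apply]; ring
  map_smul' r φ := by
    simp only [LieLaw.coeff, map_smul, Pi.smul_apply, smul_eq_mul, RingHom.id_apply]; ring

/-- The coordinate `X₄ ∧ X₅ ↦ X₆` of 2-cochains of `L73 p`; it vanishes on coboundaries. -/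
def L73Form' (p : ℝ) : twoCochain ℝ (L73 p).Alg (L73 p).Alg →ₗ[ℝ] ℝ where
  toFun φ := (L73 p).coeff φ 3 4 5
  map_add' φ ψ := by simp only [LieLaw.coeff, map_add, Pi.add_apply]
  map_smul' r φ := by
    simp only [LieLaw.coeff, map_smul, Pi.smul_apply, RingHom.id_apply]

theorem L73Form_d₁₂ {p : ℝ} (f : oneCochain ℝ (L73 p).Alg (L73 p).Alg) :
    L73Form p (d₁₂ ℝ _ _ f) = 0 := sub_eq_zero.2 (L73_coeff_d₁₂ f).2

theorem L73Form'_d₁₂ {p : ℝ} (f : oneCochain ℝ (L73 p).Alg (L73 p).Alg) :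
    L73Form' p (d₁₂ ℝ _ _ f) = 0 := (L73_coeff_d₁₂ f).1

/-- Under `ad X₇` the product `X₄ ∧ X₅` has weight `-2` and `X₆` has weight `-p`, so for `p ≠ 2` a
harmonic cocycle has no such component. -/
theorem L73Form'_eq_zero {p : ℝ} (hp2 : p ≠ 2) {φ}
    (hφ : φ ∈ twoCocycle ℝ (L73 p).Alg (L73 p).Alg) : L73Form' p φ = 0 := by
  obtain ⟨ψ, f, hψ, rfl⟩ := exists_isHarmonic_add_d₁₂ (L73 p).basis L73_weight_pos hφ
  rw [map_add, L73Form'_d₁₂, add_zero]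
  refine L73_coeff_weight hψ 3 4 5 fun h => hp2 ?_
  simp at h
  linarith

/-- Both forms depend only on the cohomology class, so they vanish on the harmonic representative,
which is then zero. -/
theorem L73_exists_d₁₂ {p : ℝ} (hp : p ≠ 0) {φ}
    (hφ : φ ∈ twoCocycle ℝ (L73 p).Alg (L73 p).Alg) (h : L73Form p φ = 0)
    (h' : L73Form' p φ = 0) : ∃ f, d₁₂ ℝ _ _ f = φ := by
  obtain ⟨ψ, f, hψ, rfl⟩ := exists_isHarmonic_add_d₁₂ (L73 p).basis L73_weight_pos hφ
  rw [map_add, L73Form_d₁₂, add_zero] at h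
  rw [map_add, L73Form'_d₁₂, add_zero] at h'
  refine ⟨f, ?_⟩
  rw [LieLaw.eq_zero_of_coeff (L73_coeff_eq_zero hp hψ h' (sub_eq_zero.1 h)), zero_add]

theorem LieLaw.coeff_tableCochain {n : ℕ} (μ : LieLaw n) (l : List (ℕ × ℕ × ℕ × ℝ)) :
    μ.coeff (tableCochain μ l) = tableTensor l := by
  ext i j k
  rw [LieLaw.coeff, cochainCoeff_apply, LieLaw.basis_apply, LieLaw.basis_apply]
  exact congrFun (tensorMap_single (tableTensor l) i j) k

theorem L73Form_phi1 (p : ℝ) : L73Form p (phi1 p) = 1 := by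
  simp [L73Form, phi1, LieLaw.coeff_tableCochain, tableTensor]

theorem L73Form_phi2 (p : ℝ) : L73Form p (phi2 p) = 0 := by
  simp [L73Form, phi2, LieLaw.coeff_tableCochain, tableTensor]

theorem L73Form'_phi1 (p : ℝ) : L73Form' p (phi1 p) = 0 := by
  change (L73 p).coeff (tableCochain _ _) 3 4 5 = 0
  simp [LieLaw.coeff_tableCochain, tableTensor]

theorem L73Form'_phi2 (p : ℝ) : L73Form' p (phi2 p) = 1 := by
  change (L73 p).coeff (tableCochain _ _) 3 4 5 = 1
  simp [LieLaw.coeff_tableCochain, tableTensor]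

/-- A cochain given by a table is a cocycle if it satisfies the linearized Jacobi identity. -/
theorem LieLaw.tableCochain_mem_twoCocycle {n : ℕ} (μ : LieLaw n) (l : List (ℕ × ℕ × ℕ × ℝ))
    (h : ∀ x y z : Fin n → ℝ,
      μ.bracket x (tensorMap (tableTensor l) y z) - μ.bracket y (tensorMap (tableTensor l) x z) +
      μ.bracket z (tensorMap (tableTensor l) x y) - tensorMap (tableTensor l) (μ.bracket x y) z +
      tensorMap (tableTensor l) (μ.bracket x z) y -
      tensorMap (tableTensor l) (μ.bracket y z) x = 0) :
    tableCochain μ l ∈ twoCocycle ℝ μ.Alg μ.Alg := by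
  rw [mem_twoCocycle_iff]
  ext x y z
  rw [d₂₃_apply]
  exact h x y z

theorem phi1_mem_twoCocycle (p : ℝ) : phi1 p ∈ twoCocycle ℝ (L73 p).Alg (L73 p).Alg := by
  have h : ∀ x y : Fin 7 → ℝ, tensorMap (tableTensor [(6, 7, 6, 1)]) x y =
      ![0, 0, 0, 0, 0, x 5 * y 6 - x 6 * y 5, 0] := fun x y => by
    ext k
    fin_cases k <;> simp [tensorMap_tableTensor, coord_seven]
  refine LieLaw.tableCochain_mem_twoCocycle _ _ fun x y z => ?_
  ext k
  fin_cases k <;> simp [h, L73_bracket] <;> ring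

theorem phi2_mem_twoCocycle : phi2 2 ∈ twoCocycle ℝ (L73 2).Alg (L73 2).Alg := by
  have h : ∀ x y : Fin 7 → ℝ, tensorMap (tableTensor [(4, 5, 6, 1)]) x y =
      ![0, 0, 0, 0, 0, x 3 * y 4 - x 4 * y 3, 0] := fun x y => by
    ext k
    fin_cases k <;> simp [tensorMap_tableTensor, coord_seven]
  refine LieLaw.tableCochain_mem_twoCocycle _ _ fun x y z => ?_
  ext k
  fin_cases k <;> simp [h, L73_bracket] <;> ring

theorem cohomologyClass_eq_zero_iff {L : Type*} [LieRing L] [LieAlgebra ℝ L]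
    {φ : twoCochain ℝ L L} (hφ : φ ∈ twoCocycle ℝ L L) :
    cohomologyClass φ hφ = 0 ↔ ∃ f, d₁₂ ℝ L L f = φ :=
  (Submodule.Quotient.mk_eq_zero _).trans Iff.rfl

theorem L73_span_phi1 {p : ℝ} (hp : p ≠ 0) (hp2 : p ≠ 2) :
    Submodule.span ℝ {cohomologyClass (phi1 p) (phi1_mem_twoCocycle p)} = ⊤ := by
  rw [Submodule.eq_top_iff']
  intro q
  obtain ⟨⟨φ, hφ⟩, rfl⟩ := Submodule.Quotient.mk_surjective _ q
  rw [Submodule.mem_span_singleton]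
  -- The form takes the value `1` on `φ₁`, so its value on `φ` is the coefficient.
  refine ⟨L73Form p φ, (sub_eq_zero.1 ?_).symm⟩
  have hmem := sub_mem hφ (Submodule.smul_mem _ (L73Form p φ) (phi1_mem_twoCocycle p))
  refine (cohomologyClass_eq_zero_iff hmem).2 (L73_exists_d₁₂ hp hmem ?_ ?_)
  · simp [L73Form_phi1]
  · exact L73Form'_eq_zero hp2 hmem

theorem L73_finrank {p : ℝ} (hp : p ≠ 0) (hp2 : p ≠ 2) :
    Module.finrank ℝ (AdjointH2 (L73 p).Alg) = 1 := by
  refine (finrank_eq_one_iff_of_nonzero _ ?_).2 (L73_span_phi1 hp hp2)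
  rw [Ne, cohomologyClass_eq_zero_iff]
  rintro ⟨f, hf⟩
  have := L73Form_phi1 p
  rw [← hf, L73Form_d₁₂] at this
  exact zero_ne_one this

theorem L73_two_span_phi1_phi2 : Submodule.span ℝ
    {cohomologyClass (phi1 2) (phi1_mem_twoCocycle 2),
      cohomologyClass (phi2 2) phi2_mem_twoCocycle} = ⊤ := by
  rw [Submodule.eq_top_iff']
  intro q
  obtain ⟨⟨φ, hφ⟩, rfl⟩ := Submodule.Quotient.mk_surjective _ q
  rw [Submodule.mem_span_pair]
  -- The two forms are dual to `φ₁, φ₂`, which gives the coefficients here and linear independence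
  -- in the dimension count.
  refine ⟨L73Form 2 φ, L73Form' 2 φ, (sub_eq_zero.1 ?_).symm⟩
  have hmem := sub_mem hφ (add_mem
    (Submodule.smul_mem _ (L73Form 2 φ) (phi1_mem_twoCocycle 2))
    (Submodule.smul_mem _ (L73Form' 2 φ) phi2_mem_twoCocycle))
  refine (cohomologyClass_eq_zero_iff hmem).2 (L73_exists_d₁₂ two_ne_zero hmem ?_ ?_)
  · simp [L73Form_phi1, L73Form_phi2]
  · simp [L73Form'_phi1, L73Form'_phi2]

theorem L73_two_finrank : Module.finrank ℝ (AdjointH2 (L73 2).Alg) = 2 := by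
  have hli : LinearIndependent ℝ ![cohomologyClass (phi1 2) (phi1_mem_twoCocycle 2),
      cohomologyClass (phi2 2) phi2_mem_twoCocycle] := by
    rw [LinearIndependent.pair_iff]
    intro s t hst
    obtain ⟨f, hf⟩ := (cohomologyClass_eq_zero_iff (add_mem
      (Submodule.smul_mem _ s (phi1_mem_twoCocycle 2))
      (Submodule.smul_mem _ t phi2_mem_twoCocycle))).1 hst
    have h := L73Form_d₁₂ f
    have h' := L73Form'_d₁₂ f
    rw [hf] at h h'
    simp only [map_add, map_smul, L73Form_phi1, L73Form_phi2, L73Form'_phi1, L73Form'_phi2,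
      smul_eq_mul, mul_one, mul_zero, add_zero, zero_add] at h h'
    exact ⟨h, h'⟩
  have h := finrank_span_eq_card hli
  rwa [Matrix.range_cons, Matrix.range_cons, Matrix.range_empty, Set.union_empty,
    Set.singleton_union, L73_two_span_phi1_phi2, finrank_top, Fintype.card_fin] at h

/-! ### The algebra `L_{7,4}`. -/

theorem L74_bracket (x y : Fin 7 → ℝ) : L74.bracket x y =
    ![(x 1 * y 2 - x 2 * y 1),
      2 * (x 0 * y 1 - x 1 * y 0),
      -2 * (x 0 * y 2 - x 2 * y 0),
      (x 0 * y 3 - x 3 * y 0) + (x 1 * y 4 - x 4 * y 1) + (x 3 * y 6 - x 6 * y 3),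
      -(x 0 * y 4 - x 4 * y 0) + (x 2 * y 3 - x 3 * y 2) + (x 4 * y 6 - x 6 * y 4),
      (x 3 * y 4 - x 4 * y 3) + 2 * (x 5 * y 6 - x 6 * y 5),
      0] := by
  ext k
  fin_cases k <;>
    simp [LieLaw.bracket, L74, tensorMap_tableTensor, sl2Table, coord_seven] <;> ring

theorem L74_ad₁ (x : Fin 7 → ℝ) : L74.bracket (Pi.single 1 1) x =
    ![x 2, -2 * x 0, 0, x 4, 0, 0, 0] := by
  ext k
  fin_cases k <;> simp [L74_bracket]

theorem L74_ad₂ (x : Fin 7 → ℝ) : L74.bracket (Pi.single 2 1) x =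
    ![-x 1, 0, 2 * x 0, 0, x 3, 0, 0] := by
  ext k
  fin_cases k <;> simp [L74_bracket]

/-- The indices of the cochains of weight zero on `L74`. -/
def L74Support : List (Fin 7 × Fin 7 × Fin 7) :=
  [(0, 1, 1), (0, 2, 2), (0, 3, 3), (0, 4, 4), (0, 5, 5), (0, 6, 0), (0, 6, 6), (1, 2, 0),
  (1, 2, 6), (1, 4, 3), (1, 6, 1), (2, 3, 4), (2, 6, 2), (3, 4, 5), (3, 6, 3), (4, 6, 4),
  (5, 6, 5)]

theorem mem_L74Support : ∀ i j k : Fin 7, i < j →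
    (![0, 2, -2, 1, -1, 0, 0] : Fin 7 → ℤ) k = ![0, 2, -2, 1, -1, 0, 0] i + ![0, 2, -2, 1, -1, 0, 0] j →
    (![0, 0, 0, -1, -1, -2, 0] : Fin 7 → ℤ) k = ![0, 0, 0, -1, -1, -2, 0] i + ![0, 0, 0, -1, -1, -2, 0] j →
    (i, j, k) ∈ L74Support := by decide

-- Compared with `L_{7,3}^2`, the bracket `[X₄, X₅] = X₆` is nonzero. The cocycle equation on `X₄,
-- X₅, X₇` now ties the change of the `X₇`-weight of `X₆` to those of `X₄` and `X₅`, which removes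
-- the class of `φ₁`. A change of the bracket `[X₄, X₅]` is the coboundary of a rescaling of `X₄,
-- X₅`, which removes that of `φ₂`; this is the relation `o₃`.
set_option maxHeartbeats 1000000 in
theorem L74_coeff_eq_zero {ψ} (hψ : IsHarmonic L74.basis ![2, 1, 1, 1, 1, 1, 1] ψ) (i j k : Fin 7)
    (hij : i < j) : L74.coeff ψ i j k = 0 := by
  have hw : ∀ i, 0 < (![2, 1, 1, 1, 1, 1, 1] : Fin 7 → ℝ) i := by simp [Fin.forall_fin_succ]
  have h₀ := hψ.coeff_intWeight hw 0 ![0, 2, -2, 1, -1, 0, 0] (fun x k => by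
    fin_cases k <;> simp [L74_bracket]) i j k
  have h₆ := hψ.coeff_intWeight hw 6 ![0, 0, 0, -1, -1, -2, 0] (fun x k => by
    fin_cases k <;> simp [L74_bracket]) i j k
  have h₁ := hψ.coeff_invariant hw 1 L74_ad₁ L74_ad₂
    (B := fun x => ![-2 * x 1, 0, x 0, 0, x 3, 0, 0])
    (fun x i => by fin_cases i <;> simp [Fin.sum_univ_seven])
    (fun x i => by fin_cases i <;> simp)
  have h₂ := hψ.coeff_invariant hw 1 L74_ad₂ L74_ad₁
    (B := fun x => ![2 * x 2, -x 0, 0, x 4, 0, 0, 0])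
    (fun x i => by fin_cases i <;> simp [Fin.sum_univ_seven])
    (fun x i => by fin_cases i <;> simp)
  have hs : ∀ i j k, j < i → L74.coeff ψ i j k = -L74.coeff ψ j i k := fun i j k _ =>
    LieLaw.coeff_skew ψ i j k
  have hd : ∀ i k, L74.coeff ψ i i k = 0 := LieLaw.coeff_self ψ
  have hc := hψ.coeff_cocycle
  have o₁ := hψ.coeff_orthogonal_table rfl ![1, 1, 1, 0, 0, 0, 0]
  have o₂ := hψ.coeff_orthogonal_table rfl ![0, 0, 0, 0, 0, 0, 1]
  have o₃ := hψ.coeff_orthogonal_table rfl ![0, 0, 0, 1, 1, 0, 0]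
  generalize L74.coeff ψ = c at *
  have hzero : ∀ t ∈ L74Support, c t.1 t.2.1 t.2.2 = 0 := by
    have e₁ := h₁ 0 2 6
    have e₂ := h₁ 2 5 5
    have e₃ := h₁ 2 6 6
    have e₄ := h₁ 0 2 0
    have e₅ := h₁ 0 6 1
    have e₆ := h₁ 1 2 1
    have e₇ := h₁ 2 3 3
    have e₈ := h₁ 2 4 4
    have e₉ := h₁ 2 6 0
    have e₁₀ := h₁ 4 6 3
    have e₁₁ := h₂ 1 3 3
    have e₁₂ := hc 0 1 6 1
    have e₁₃ := hc 0 1 4 3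
    have e₁₄ := hc 3 4 6 5
    simp [L74_bracket, Fin.sum_univ_seven, hs, hd]
      at e₁ e₂ e₃ e₄ e₅ e₆ e₇ e₈ e₉ e₁₀ e₁₁ e₁₂ e₁₃ e₁₄
    simp [sl2Table, coord_seven, hs] at o₁ o₂ o₃
    clear hs hd h₁ h₂ hc h₀ h₆
    simp only [L74Support, List.forall_mem_cons, List.not_mem_nil, false_imp_iff, implies_true,
      and_true]
    constructorm* _ ∧ _ <;> grind only
  by_contra hne
  exact hne (hzero (i, j, k) (mem_L74Support i j k hij (not_not.1 (mt h₀ hne)) (not_not.1 (mt h₆ hne))))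

theorem L74_subsingleton_adjointH2 : Subsingleton (AdjointH2 L74.Alg) :=
  LieLaw.subsingleton_adjointH2 L74 (w := ![2, 1, 1, 1, 1, 1, 1]) (by simp [Fin.forall_fin_succ])
    fun _ hψ => L74_coeff_eq_zero hψ

/-! ### The algebra `L_{7,5}`. -/

theorem L75_bracket (x y : Fin 7 → ℝ) : L75.bracket x y =
    ![(x 1 * y 2 - x 2 * y 1),
      2 * (x 0 * y 1 - x 1 * y 0),
      -2 * (x 0 * y 2 - x 2 * y 0),
      2 * (x 0 * y 3 - x 3 * y 0) + 2 * (x 1 * y 4 - x 4 * y 1) + (x 3 * y 6 - x 6 * y 3),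
      (x 1 * y 5 - x 5 * y 1) + (x 2 * y 3 - x 3 * y 2) + (x 4 * y 6 - x 6 * y 4),
      -2 * (x 0 * y 5 - x 5 * y 0) + 2 * (x 2 * y 4 - x 4 * y 2) + (x 5 * y 6 - x 6 * y 5),
      0] := by
  ext k
  fin_cases k <;>
    simp [LieLaw.bracket, L75, tensorMap_tableTensor, sl2Table, coord_seven] <;> ring

theorem L75_ad₁ (x : Fin 7 → ℝ) : L75.bracket (Pi.single 1 1) x =
    ![x 2, -2 * x 0, 0, 2 * x 4, x 5, 0, 0] := by
  ext k
  fin_cases k <;> simp [L75_bracket]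

theorem L75_ad₂ (x : Fin 7 → ℝ) : L75.bracket (Pi.single 2 1) x =
    ![-x 1, 0, 2 * x 0, 0, x 3, 2 * x 4, 0] := by
  ext k
  fin_cases k <;> simp [L75_bracket]

/-- The indices of the cochains of weight zero on `L75`. -/
def L75Support : List (Fin 7 × Fin 7 × Fin 7) :=
  [(0, 1, 1), (0, 2, 2), (0, 3, 3), (0, 4, 4), (0, 5, 5), (0, 6, 0), (0, 6, 6), (1, 2, 0),
  (1, 2, 6), (1, 4, 3), (1, 5, 4), (1, 6, 1), (2, 3, 4), (2, 4, 5), (2, 6, 2), (3, 6, 3),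
  (4, 6, 4), (5, 6, 5)]

theorem mem_L75Support : ∀ i j k : Fin 7, i < j →
    (![0, 2, -2, 2, 0, -2, 0] : Fin 7 → ℤ) k = ![0, 2, -2, 2, 0, -2, 0] i + ![0, 2, -2, 2, 0, -2, 0] j →
    (![0, 0, 0, -1, -1, -1, 0] : Fin 7 → ℤ) k = ![0, 0, 0, -1, -1, -1, 0] i + ![0, 0, 0, -1, -1, -1, 0] j →
    (i, j, k) ∈ L75Support := by decide

-- The complexification is that of `L_{7,1}`, and the same four scalars are eliminated in the same
-- way. The entry `2` at `X₅` in the form makes `X₂` and `X₃` adjoint on the three-dimensional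
-- module.
set_option maxHeartbeats 1000000 in
theorem L75_coeff_eq_zero {ψ} (hψ : IsHarmonic L75.basis ![2, 1, 1, 1, 2, 1, 1] ψ) (i j k : Fin 7)
    (hij : i < j) : L75.coeff ψ i j k = 0 := by
  have hw : ∀ i, 0 < (![2, 1, 1, 1, 2, 1, 1] : Fin 7 → ℝ) i := by simp [Fin.forall_fin_succ]
  have h₀ := hψ.coeff_intWeight hw 0 ![0, 2, -2, 2, 0, -2, 0] (fun x k => by
    fin_cases k <;> simp [L75_bracket]) i j k
  have h₆ := hψ.coeff_intWeight hw 6 ![0, 0, 0, -1, -1, -1, 0] (fun x k => by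
    fin_cases k <;> simp [L75_bracket]) i j k
  have h₁ := hψ.coeff_invariant hw 1 L75_ad₁ L75_ad₂
    (B := fun x => ![-2 * x 1, 0, x 0, 0, 2 * x 3, x 4, 0])
    (fun x i => by fin_cases i <;> simp [Fin.sum_univ_seven])
    (fun x i => by fin_cases i <;> simp)
  have h₂ := hψ.coeff_invariant hw 1 L75_ad₂ L75_ad₁
    (B := fun x => ![2 * x 2, -x 0, 0, x 4, 2 * x 5, 0, 0])
    (fun x i => by fin_cases i <;> simp [Fin.sum_univ_seven])
    (fun x i => by fin_cases i <;> simp)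
  have hs : ∀ i j k, j < i → L75.coeff ψ i j k = -L75.coeff ψ j i k := fun i j k _ =>
    LieLaw.coeff_skew ψ i j k
  have hd : ∀ i k, L75.coeff ψ i i k = 0 := LieLaw.coeff_self ψ
  have hc := hψ.coeff_cocycle
  have o₁ := hψ.coeff_orthogonal_table rfl ![1, 1, 1, 0, 0, 0, 0]
  have o₂ := hψ.coeff_orthogonal_table rfl ![0, 0, 0, 0, 0, 0, 1]
  generalize L75.coeff ψ = c at *
  have hzero : ∀ t ∈ L75Support, c t.1 t.2.1 t.2.2 = 0 := by
    have e₁ := h₁ 0 2 6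
    have e₂ := h₁ 2 6 6
    have e₃ := h₁ 0 2 0
    have e₄ := h₁ 0 6 1
    have e₅ := h₁ 1 2 1
    have e₆ := h₁ 1 5 3
    have e₇ := h₁ 2 3 3
    have e₈ := h₁ 2 5 5
    have e₉ := h₁ 2 6 0
    have e₁₀ := h₁ 4 6 3
    have e₁₁ := h₁ 5 6 4
    have e₁₂ := h₂ 1 3 3
    have e₁₃ := h₂ 1 5 5
    have e₁₄ := h₁ 0 4 3
    have e₁₅ := hc 0 1 6 1
    have e₁₆ := hc 0 1 4 3
    simp [L75_bracket, Fin.sum_univ_seven, hs, hd]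
      at e₁ e₂ e₃ e₄ e₅ e₆ e₇ e₈ e₉ e₁₀ e₁₁ e₁₂ e₁₃ e₁₄ e₁₅ e₁₆
    simp [sl2Table, coord_seven, hs] at o₁ o₂
    clear hs hd h₁ h₂ hc h₀ h₆
    simp only [L75Support, List.forall_mem_cons, List.not_mem_nil, false_imp_iff, implies_true,
      and_true]
    constructorm* _ ∧ _ <;> grind only
  by_contra hne
  exact hne (hzero (i, j, k) (mem_L75Support i j k hij (not_not.1 (mt h₀ hne)) (not_not.1 (mt h₆ hne))))

theorem L75_subsingleton_adjointH2 : Subsingleton (AdjointH2 L75.Alg) :=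
  LieLaw.subsingleton_adjointH2 L75 (w := ![2, 1, 1, 1, 2, 1, 1]) (by simp [Fin.forall_fin_succ])
    fun _ hψ => L75_coeff_eq_zero hψ

/-! ### The algebra `L_{7,6}`. -/

theorem L76_bracket (x y : Fin 7 → ℝ) : L76.bracket x y =
    ![(x 1 * y 2 - x 2 * y 1),
      2 * (x 0 * y 1 - x 1 * y 0),
      -2 * (x 0 * y 2 - x 2 * y 0),
      3 * (x 0 * y 3 - x 3 * y 0) + 3 * (x 1 * y 4 - x 4 * y 1),
      (x 0 * y 4 - x 4 * y 0) + 2 * (x 1 * y 5 - x 5 * y 1) + (x 2 * y 3 - x 3 * y 2),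
      -(x 0 * y 5 - x 5 * y 0) + (x 1 * y 6 - x 6 * y 1) + 2 * (x 2 * y 4 - x 4 * y 2),
      -3 * (x 0 * y 6 - x 6 * y 0) + 3 * (x 2 * y 5 - x 5 * y 2)] := by
  ext k
  fin_cases k <;>
    simp [LieLaw.bracket, L76, tensorMap_tableTensor, sl2Table, coord_seven] <;> ring

theorem L76_ad₁ (x : Fin 7 → ℝ) : L76.bracket (Pi.single 1 1) x =
    ![x 2, -2 * x 0, 0, 3 * x 4, 2 * x 5, x 6, 0] := by
  ext k
  fin_cases k <;> simp [L76_bracket]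

theorem L76_ad₂ (x : Fin 7 → ℝ) : L76.bracket (Pi.single 2 1) x =
    ![-x 1, 0, 2 * x 0, 0, x 3, 2 * x 4, 3 * x 5] := by
  ext k
  fin_cases k <;> simp [L76_bracket]

/-- The indices of the cochains of weight zero on `L76`. -/
def L76Support : List (Fin 7 × Fin 7 × Fin 7) :=
  [(0, 1, 1), (0, 2, 2), (0, 3, 3), (0, 4, 4), (0, 5, 5), (0, 6, 6), (1, 2, 0), (1, 4, 3),
  (1, 5, 4), (1, 6, 5), (2, 3, 4), (2, 4, 5), (2, 5, 6), (3, 5, 1), (3, 6, 0), (4, 5, 0),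
  (4, 6, 2)]

theorem mem_L76Support : ∀ i j k : Fin 7, i < j →
    (![0, 2, -2, 3, 1, -1, -3] : Fin 7 → ℤ) k = ![0, 2, -2, 3, 1, -1, -3] i + ![0, 2, -2, 3, 1, -1, -3] j →
    (i, j, k) ∈ L76Support := by decide

-- The radical `V` is the irreducible module of dimension four, and the entries `1, 3, 3, 1` of the
-- form make `X₂` and `X₃` adjoint on it. `Λ²V` splits into modules of dimensions five and one, so
-- it has no equivariant map to `s`. The scalars for `Λ²s → s` and `s ⊗ V → V` are equated by a
-- cocycle equation and killed by the rescaling of `s`.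
set_option maxHeartbeats 1000000 in
theorem L76_coeff_eq_zero {ψ} (hψ : IsHarmonic L76.basis ![2, 1, 1, 1, 3, 3, 1] ψ) (i j k : Fin 7)
    (hij : i < j) : L76.coeff ψ i j k = 0 := by
  have hw : ∀ i, 0 < (![2, 1, 1, 1, 3, 3, 1] : Fin 7 → ℝ) i := by simp [Fin.forall_fin_succ]
  have h₀ := hψ.coeff_intWeight hw 0 ![0, 2, -2, 3, 1, -1, -3] (fun x k => by
    fin_cases k <;> simp [L76_bracket]) i j k
  have h₁ := hψ.coeff_invariant hw 1 L76_ad₁ L76_ad₂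
    (B := fun x => ![-2 * x 1, 0, x 0, 0, 3 * x 3, 2 * x 4, x 5])
    (fun x i => by fin_cases i <;> simp [Fin.sum_univ_seven])
    (fun x i => by fin_cases i <;> simp <;> ring)
  have h₂ := hψ.coeff_invariant hw 1 L76_ad₂ L76_ad₁
    (B := fun x => ![2 * x 2, -x 0, 0, x 4, 2 * x 5, 3 * x 6, 0])
    (fun x i => by fin_cases i <;> simp [Fin.sum_univ_seven])
    (fun x i => by fin_cases i <;> simp <;> ring)
  have hs : ∀ i j k, j < i → L76.coeff ψ i j k = -L76.coeff ψ j i k := fun i j k _ =>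
    LieLaw.coeff_skew ψ i j k
  have hd : ∀ i k, L76.coeff ψ i i k = 0 := LieLaw.coeff_self ψ
  have hc := hψ.coeff_cocycle
  have o₁ := hψ.coeff_orthogonal_table rfl ![1, 1, 1, 0, 0, 0, 0]
  generalize L76.coeff ψ = c at *
  have hzero : ∀ t ∈ L76Support, c t.1 t.2.1 t.2.2 = 0 := by
    have e₁ := h₁ 5 6 2
    have e₂ := h₂ 3 4 1
    have e₃ := h₁ 0 2 0
    have e₄ := h₁ 1 2 1
    have e₅ := h₁ 1 5 3
    have e₆ := h₁ 1 6 4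
    have e₇ := h₁ 2 3 3
    have e₈ := h₁ 2 6 6
    have e₉ := h₁ 3 6 1
    have e₁₀ := h₁ 4 5 1
    have e₁₁ := h₂ 1 3 3
    have e₁₂ := h₂ 1 6 6
    have e₁₃ := h₂ 2 3 5
    have e₁₄ := h₁ 0 4 3
    have e₁₅ := h₁ 0 5 4
    have e₁₆ := hc 0 1 4 3
    simp [L76_bracket, Fin.sum_univ_seven, hs, hd]
      at e₁ e₂ e₃ e₄ e₅ e₆ e₇ e₈ e₉ e₁₀ e₁₁ e₁₂ e₁₃ e₁₄ e₁₅ e₁₆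
    simp [sl2Table, coord_seven, hs] at o₁
    clear hs hd h₁ h₂ hc h₀
    simp only [L76Support, List.forall_mem_cons, List.not_mem_nil, false_imp_iff, implies_true,
      and_true]
    constructorm* _ ∧ _ <;> grind only
  by_contra hne
  exact hne (hzero (i, j, k) (mem_L76Support i j k hij (not_not.1 (mt h₀ hne))))

theorem L76_subsingleton_adjointH2 : Subsingleton (AdjointH2 L76.Alg) :=
  LieLaw.subsingleton_adjointH2 L76 (w := ![2, 1, 1, 1, 3, 3, 1]) (by simp [Fin.forall_fin_succ])
    fun _ hψ => L76_coeff_eq_zero hψ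

/-! ### The algebra `L_{7,7}`. -/

theorem L77_bracket (x y : Fin 7 → ℝ) : L77.bracket x y =
    ![(x 1 * y 2 - x 2 * y 1),
      2 * (x 0 * y 1 - x 1 * y 0),
      -2 * (x 0 * y 2 - x 2 * y 0),
      (x 0 * y 3 - x 3 * y 0) + (x 1 * y 4 - x 4 * y 1),
      -(x 0 * y 4 - x 4 * y 0) + (x 2 * y 3 - x 3 * y 2),
      (x 0 * y 5 - x 5 * y 0) + (x 1 * y 6 - x 6 * y 1),
      -(x 0 * y 6 - x 6 * y 0) + (x 2 * y 5 - x 5 * y 2)] := by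
  ext k
  fin_cases k <;>
    simp [LieLaw.bracket, L77, tensorMap_tableTensor, sl2Table, coord_seven]

theorem L77_ad₁ (x : Fin 7 → ℝ) : L77.bracket (Pi.single 1 1) x =
    ![x 2, -2 * x 0, 0, x 4, 0, x 6, 0] := by
  ext k
  fin_cases k <;> simp [L77_bracket]

theorem L77_ad₂ (x : Fin 7 → ℝ) : L77.bracket (Pi.single 2 1) x =
    ![-x 1, 0, 2 * x 0, 0, x 3, 0, x 5] := by
  ext k
  fin_cases k <;> simp [L77_bracket]

/-- The indices of the cochains of weight zero on `L77`. -/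
def L77Support : List (Fin 7 × Fin 7 × Fin 7) :=
  [(0, 1, 1), (0, 2, 2), (0, 3, 3), (0, 3, 5), (0, 4, 4), (0, 4, 6), (0, 5, 3), (0, 5, 5),
  (0, 6, 4), (0, 6, 6), (1, 2, 0), (1, 4, 3), (1, 4, 5), (1, 6, 3), (1, 6, 5), (2, 3, 4),
  (2, 3, 6), (2, 5, 4), (2, 5, 6), (3, 4, 0), (3, 5, 1), (3, 6, 0), (4, 5, 0), (4, 6, 2),
  (5, 6, 0)]

theorem mem_L77Support : ∀ i j k : Fin 7, i < j →
    (![0, 2, -2, 1, -1, 1, -1] : Fin 7 → ℤ) k = ![0, 2, -2, 1, -1, 1, -1] i + ![0, 2, -2, 1, -1, 1, -1] j →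
    (i, j, k) ∈ L77Support := by decide

-- The complexification is that of `L_{7,2}`, and six scalars survive invariance again. The
-- commutant of the action on the radical `V` consists of the real `2 × 2` matrices. Cocycle
-- equations kill the off-diagonal entries and the map `Λ²V → s`, and equate the diagonal entries
-- with the scalar for `Λ²s → s`; the rescaling of `s` removes the rest.
set_option maxHeartbeats 1000000 in
theorem L77_coeff_eq_zero {ψ} (hψ : IsHarmonic L77.basis ![2, 1, 1, 1, 1, 1, 1] ψ) (i j k : Fin 7)
    (hij : i < j) : L77.coeff ψ i j k = 0 := by
  have hw : ∀ i, 0 < (![2, 1, 1, 1, 1, 1, 1] : Fin 7 → ℝ) i := by simp [Fin.forall_fin_succ]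
  have h₀ := hψ.coeff_intWeight hw 0 ![0, 2, -2, 1, -1, 1, -1] (fun x k => by
    fin_cases k <;> simp [L77_bracket]) i j k
  have h₁ := hψ.coeff_invariant hw 1 L77_ad₁ L77_ad₂
    (B := fun x => ![-2 * x 1, 0, x 0, 0, x 3, 0, x 5])
    (fun x i => by fin_cases i <;> simp [Fin.sum_univ_seven])
    (fun x i => by fin_cases i <;> simp)
  have h₂ := hψ.coeff_invariant hw 1 L77_ad₂ L77_ad₁
    (B := fun x => ![2 * x 2, -x 0, 0, x 4, 0, x 6, 0])
    (fun x i => by fin_cases i <;> simp [Fin.sum_univ_seven])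
    (fun x i => by fin_cases i <;> simp)
  have hs : ∀ i j k, j < i → L77.coeff ψ i j k = -L77.coeff ψ j i k := fun i j k _ =>
    LieLaw.coeff_skew ψ i j k
  have hd : ∀ i k, L77.coeff ψ i i k = 0 := LieLaw.coeff_self ψ
  have hc := hψ.coeff_cocycle
  have o₁ := hψ.coeff_orthogonal_table rfl ![1, 1, 1, 0, 0, 0, 0]
  generalize L77.coeff ψ = c at *
  have hzero : ∀ t ∈ L77Support, c t.1 t.2.1 t.2.2 = 0 := by
    have e₁ := h₁ 3 4 1
    have e₂ := h₁ 5 6 1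
    have e₃ := h₁ 0 2 0
    have e₄ := h₁ 1 2 1
    have e₅ := h₁ 2 3 3
    have e₆ := h₁ 2 3 5
    have e₇ := h₁ 2 4 4
    have e₈ := h₁ 2 4 6
    have e₉ := h₁ 2 5 3
    have e₁₀ := h₁ 2 5 5
    have e₁₁ := h₁ 2 6 4
    have e₁₂ := h₁ 2 6 6
    have e₁₃ := h₁ 3 6 1
    have e₁₄ := h₁ 4 5 1
    have e₁₅ := h₂ 1 3 3
    have e₁₆ := h₂ 1 3 5
    have e₁₇ := h₂ 1 5 3
    have e₁₈ := h₂ 1 5 5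
    have e₁₉ := h₂ 3 6 2
    have e₂₀ := hc 0 1 4 5
    have e₂₁ := hc 0 1 6 3
    have e₂₂ := hc 3 4 5 3
    have e₂₃ := hc 0 1 4 3
    have e₂₄ := hc 0 1 6 5
    simp [L77_bracket, Fin.sum_univ_seven, hs, hd]
      at e₁ e₂ e₃ e₄ e₅ e₆ e₇ e₈ e₉ e₁₀ e₁₁ e₁₂ e₁₃ e₁₄ e₁₅ e₁₆ e₁₇ e₁₈ e₁₉ e₂₀ e₂₁ e₂₂ e₂₃ e₂₄
    simp [sl2Table, coord_seven, hs] at o₁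
    clear hs hd h₁ h₂ hc h₀
    simp only [L77Support, List.forall_mem_cons, List.not_mem_nil, false_imp_iff, implies_true,
      and_true]
    constructorm* _ ∧ _ <;> grind only
  by_contra hne
  exact hne (hzero (i, j, k) (mem_L77Support i j k hij (not_not.1 (mt h₀ hne))))

theorem L77_subsingleton_adjointH2 : Subsingleton (AdjointH2 L77.Alg) :=
  LieLaw.subsingleton_adjointH2 L77 (w := ![2, 1, 1, 1, 1, 1, 1]) (by simp [Fin.forall_fin_succ])
    fun _ hψ => L77_coeff_eq_zero hψ

end

/-! ### Assembly of the results. -/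

theorem proposition4 :
    (∀ μ ∈ ({L71, L72, L74, L75, L76, L77} : Set (LieLaw 7)),
      Subsingleton (AdjointH2 μ.Alg) ∧ μ.IsStable) ∧
    (∀ p : ℝ, p ≠ 0 → p ≠ 2 →
      Module.finrank ℝ (AdjointH2 (L73 p).Alg) = 1 ∧
      ∃ h₁ : phi1 p ∈ twoCocycle ℝ (L73 p).Alg (L73 p).Alg,
        Submodule.span ℝ {cohomologyClass (phi1 p) h₁} = ⊤) ∧
    (Module.finrank ℝ (AdjointH2 (L73 2).Alg) = 2 ∧
      ∃ (h₁ : phi1 2 ∈ twoCocycle ℝ (L73 2).Alg (L73 2).Alg)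
        (h₂ : phi2 2 ∈ twoCocycle ℝ (L73 2).Alg (L73 2).Alg),
        Submodule.span ℝ {cohomologyClass (phi1 2) h₁, cohomologyClass (phi2 2) h₂} = ⊤) := by
  refine ⟨?_, fun p hp hp2 => ⟨L73_finrank hp hp2, phi1_mem_twoCocycle p, L73_span_phi1 hp hp2⟩,
    L73_two_finrank, phi1_mem_twoCocycle 2, phi2_mem_twoCocycle, L73_two_span_phi1_phi2⟩
  intro μ hμ
  suffices h : Subsingleton (AdjointH2 μ.Alg) from ⟨h, μ.isStable_of_subsingleton_adjointH2 h⟩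
  rcases hμ with rfl | rfl | rfl | rfl | rfl | rfl
  exacts [L71_subsingleton_adjointH2, L72_subsingleton_adjointH2, L74_subsingleton_adjointH2,
    L75_subsingleton_adjointH2, L76_subsingleton_adjointH2, L77_subsingleton_adjointH2]
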